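/- **Setting.** Consider a mobility sharing system with a finite set $\mathcal V$ of service areas, area $i$ being of category $\kappa_i\in\{1,\dots,M\}$; write $\mathcal V_m=\{i:\kappa_i=m\}$. Rebalancing takes place at discrete instants that alternate between morning and evening. The state is $s=(\tau,(v_i)_{i\in\mathcal V})$, where $\tau$ is the time of day and $v_i\in\{0,\dots,\sigma_i\}$ is the number of vehicles in area $i$; the local state of area $i$ is $s_i=(\tau,v_i)\in\mathcal S_i$. Agent $i$ chooses $a_i$ from a finite nonempty set $\mathcal A_i\subset\mathbb Z$ of numbers of vehicles to add or remove, and $\mathcal A=\prod_i\mathcal A_i$. Given $s$ and $\mathbf a=(a_i)$, the time of day switches and the pairs $(v_i',f_i)$ of next number of vehicles and number of failures in area $i$ are independent across areas, the law of $(v_i',f_i)$ on $\{0,\dots,\sigma_i\}\times\mathbb N$ depending only on $(i,s_i,a_i)$; it is arbitrary, with $\mathbb E[f_i^2]<\infty$. With real constants $\alpha,\xi$, a function $\phi:\{1,\dots,M\}\to\mathbb R$, functions $\ell_i:\mathbb N\times\mathbb N\to\mathbb R$, expected demands $\mu_i(\tau)\in\mathbb N$, and $[z]_*=0$ if $z=0$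 and $[z]_*=1$ otherwise, the global and the local rewards are $$R=-\alpha\sum_{m=1}^M\phi(m)\sum_{i\in\mathcal V_m}[a_i]_*-\sum_{i\in\mathcal V}f_i-\xi\sum_{i\in\mathcal V}\ell_i(v_i,\mu_i(\tau)),\qquad R_i=-\alpha\phi(\kappa_i)[a_i]_*-f_i-\xi\,\ell_i(v_i,\mu_i(\tau)).$$ Let $\gamma\in[0,1)$. For a (possibly randomised) stationary policy $\pi$, the value $v_\pi(s)$ is the expectation of $\sum_{k\ge0}\gamma^kR(k+1)$ when the process starts in $s$ and follows $\pi$; here $R(k+1)$ is the reward of the transition from instant $k$ to $k+1$. The *multi-agent problem* asks for $\pi^*:\mathcal S\to\mathcal A$ that maximises $v_\pi(s)$ simultaneously for all $s$, with reward $R$. The *single-area problem* $i$ asks for $\pi_i^*:\mathcal S_i\to\mathcal A_i$ that maximises the value of every $s_i$ in the decision process of area $i$ alone, with reward $R_i$. Write $v^*=\sup_\pi v_\pi$ and $Q^*(s,\mathbf a)=\mathbb E[R+\gamma v^*(s')\mid s,\mathbf a]$ for the multi-agent process and $v_i^*,Q_i^*$ for that of area $i$. **Proposition (separability).** 1. Every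 single-area problem has a solution. For policies $\pi_i:\mathcal S_i\to\mathcal A_i$, the combination $s\mapsto(\pi_i(s_i))_i$ solves the multi-agent problem if and only if $\pi_i$ solves the single-area problem $i$ for every $i$. A policy $\pi:\mathcal S\to\mathcal A$ solves the multi-agent problem if and only if for every $s$ there are solutions $\pi_i$ of the single-area problems with $\pi(s)=(\pi_i(s_i))_i$. Every solution of the multi-agent problem is also optimal among all randomised policies. For randomised $\pi_i$, the combination $\pi(\mathbf a\mid s)=\prod_i\pi_i(a_i\mid s_i)$ is optimal among randomised policies if and only if every $\pi_i$ is. 2. For all $s$ and $\mathbf a$, $v^*(s)=\sum_iv_i^*(s_i)$ and $Q^*(s,\mathbf a)=\sum_iQ_i^*(s_i,a_i)$. 3. Let the system run on a probability space with a filtration $(\mathcal F_t)$, the state, the action vector (chosen in any way) and the learning rates $\eta_{i,t}\in[0,1]$ at instant $t$ being $\mathcal F_t$-measurable, and the failures between $t$ and $t+1$ being $\mathcal F_{t+1}$-measurable; given $\mathcal F_t$, the next state and the failures follow the dynamics above. Each agent $i$ runs single-agent Q-learning on its own local states, actions and rewards: starting from any table $Q_{i,0}$, the entry of $Q_{i,t}$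 at the current pair $(s_i,a_i)$ is changed by $\eta_{i,t}\bigl(R_i+\gamma\max_{a'}Q_{i,t}(s_i',a')-Q_{i,t}(s_i,a_i)\bigr)$ and all other entries are kept. Assume the usual conditions of single-agent Q-learning: for every $i$, almost surely $\sum_t\eta_{i,t}^2<\infty$, and for every pair $(s_i,a_i)$ the sum of $\eta_{i,t}$ over the instants $t$ at which that pair occurs is infinite. Then almost surely: $Q_{i,t}\to Q_i^*$ for every $i$; $\sum_iQ_{i,t}(s_i,a_i)\to Q^*(s,\mathbf a)$ for all $s,\mathbf a$; and for all sufficiently large $t$, every combination of greedy policies for the tables $Q_{i,t}$ solves the multi-agent problem. -/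

import Mathlib

open MeasureTheory ProbabilityTheory Filter Topology

noncomputable section

/-! ### Finite Markov decision processes -/

/-- A discounted Markov decision process with state space `S` and action space `A`.
`p s a` is the joint law of the next state and of the reward that is collected when action `a` is
taken in state `s`. A reward of the form `𝓡 (s, a, s')` is the case in which the reward is a
function of the next state under `p s a`. -/
structure MDP (S A : Type*) [MeasurableSpace S] where
  p : S → A → Measure (S × ℝ)
  isProb : ∀ s a, IsProbabilityMeasure (p s a)
  γ : ℝ
  γ_nonneg : 0 ≤ γ
  γ_lt_one : γ < 1

namespace MDP

variable {S A : Type*} [MeasurableSpace S]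

/-- A (randomised, stationary) policy: `π s a` is the probability of action `a` in state `s`. -/
abbrev Policy (S A : Type*) := S → PMF A

/-- The deterministic policy `d : S → A`, as a randomised one. -/
def pure (d : S → A) : Policy S A := fun s => PMF.pure (d s)

variable [Fintype A]

/-- The law of the next state and the reward, from state `s`, when the action is drawn from
`π s`. -/
def stepLaw (M : MDP S A) (π : Policy S A) (s : S) : Measure (S × ℝ) :=
  ∑ a, π s a • M.p s a

theorem isProbabilityMeasure_stepLaw (M : MDP S A) (π : Policy S A) (s : S) :
    IsProbabilityMeasure (M.stepLaw π s) := by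
  constructor
  have h : ∀ a, M.p s a Set.univ = 1 := fun a => (M.isProb s a).measure_univ
  have h2 := (π s).tsum_coe
  rw [tsum_fintype] at h2
  simp [stepLaw, h, h2]

variable [Countable S] [MeasurableSingletonClass S]

/-- The transition kernel of the chain of pairs (state, last reward) under the policy `π`. -/
def stepKernel (M : MDP S A) (π : Policy S A) : Kernel (S × ℝ) (S × ℝ) :=
  (Kernel.ofFunOfCountable (M.stepLaw π)).comap Prod.fst measurable_fst

instance (M : MDP S A) (π : Policy S A) : IsMarkovKernel (M.stepKernel π) :=
  ⟨fun x => M.isProbabilityMeasure_stepLaw π x.1⟩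

/-- The law of the whole trajectory `n ↦ (S(n), R(n))` when the decision process is started in
`S(0) = s` and the policy `π` is followed (there is no reward at time `0`). -/
def trajLaw (M : MDP S A) (π : Policy S A) (s : S) : Measure (ℕ → S × ℝ) :=
  Kernel.trajMeasure (X := fun _ => S × ℝ) (Measure.dirac (s, 0))
    (fun n => (M.stepKernel π).comap (fun x => x ⟨n, by simp⟩) (measurable_pi_apply _))

/-- The discounted return `G(0) = ∑ₖ γᵏ R(k+1)` of a trajectory. -/
def ret (M : MDP S A) (ω : ℕ → S × ℝ) : ℝ := ∑' k, M.γ ^ k * (ω (k + 1)).2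

/-- The state value function: the expected return under `π` from the state `s`. -/
def value (M : MDP S A) (π : Policy S A) (s : S) : ℝ := ∫ ω, M.ret ω ∂(M.trajLaw π s)

/-- A deterministic policy that maximises the value of every state among the deterministic
policies, i.e. a solution `π* = argmax_{π : S → A} v_π(s)` for all `s`. -/
def Solves (M : MDP S A) (d : S → A) : Prop :=
  ∀ d' : S → A, ∀ s, M.value (pure d') s ≤ M.value (pure d) s

/-- A randomised policy that maximises the value of every state among the randomised policies. -/
def IsOptimal (M : MDP S A) (π : Policy S A) : Prop :=
  ∀ π' : Policy S A, ∀ s, M.value π' s ≤ M.value π s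

/-- The optimal state value. -/
def optValue (M : MDP S A) (s : S) : ℝ := ⨆ π : Policy S A, M.value π s

/-- The optimal action value. -/
def optQ (M : MDP S A) (s : S) (a : A) : ℝ := ∫ x, (x.2 + M.γ * M.optValue x.1) ∂(M.p s a)

end MDP

/-- `d` is a greedy policy for the table `q`. -/
def IsGreedy {S A : Type*} (q : S → A → ℝ) (d : S → A) : Prop := ∀ s a, q s a ≤ q s (d s)

open Classical in
/-- One Q-learning update of the table `q` with learning rate `η`, after action `a` was taken in
state `s`, the reward `r` was collected and `s'` was reached. -/
def qUpdate {S A : Type*} (γ η : ℝ) (q : S → A → ℝ) (s : S) (a : A) (r : ℝ) (s' : S) :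
    S → A → ℝ := fun x b =>
  if x = s ∧ b = a then q x b + η * (r + γ * (⨆ a', q s' a') - q x b) else q x b

/-! ### The mobility sharing system -/

/-- The two rebalancing instants of a day. -/
inductive DayTime
  | morning
  | evening
  deriving DecidableEq

instance : Fintype DayTime := ⟨({.morning, .evening} : Finset DayTime), fun x => by cases x <;> simp⟩

instance : MeasurableSpace DayTime := ⊤

instance : DiscreteMeasurableSpace DayTime := ⟨fun _ => trivial⟩

/-- The time of day at the next rebalancing instant. -/
def DayTime.next : DayTime → DayTime
  | .morning => .evening
  | .evening => .morning

/-- The data of a mobility sharing system with set of service areas `ι`. -/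
structure SharingSystem (ι : Type*) where
  /-- number of categories of areas -/
  M : ℕ
  /-- the category of each area -/
  κ : ι → Fin M
  /-- the largest number of vehicles in each area -/
  σ : ι → ℕ
  /-- the possible rebalancing actions in each area: numbers of vehicles added (or removed) -/
  act : ι → Finset ℤ
  act_nonempty : ∀ i, (act i).Nonempty
  /-- expected demand of each area until the next rebalancing instant -/
  μ : ι → DayTime → ℕ
  /-- weight of the rebalancing cost -/
  α : ℝ
  /-- weight of the mismatch cost -/
  ξ : ℝ
  /-- category dependent factor of the rebalancing cost -/
  φ : Fin M → ℝ
  /-- mismatch cost between the number of vehicles and the expected demand -/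
  ℓ : ι → ℕ → ℕ → ℝ
  /-- discount factor -/
  γ : ℝ
  γ_nonneg : 0 ≤ γ
  γ_lt_one : γ < 1
  /-- the dynamics of a single area between two rebalancing instants: the joint law of the number
  of vehicles at the next instant and of the number of failures in between, given the time of day,
  the present number of vehicles and the rebalancing action -/
  law : ∀ i, DayTime → Fin (σ i + 1) → act i → PMF (Fin (σ i + 1) × ℕ)
  failures_sq : ∀ i τ v a, Integrable (fun y => (y.2 : ℝ) ^ 2) (law i τ v a).toMeasure

namespace SharingSystem

variable {ι : Type*} (N : SharingSystem ι)

/-- The state of a single area: time of day and number of vehicles (the category of the area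
is the constant `N.κ i`). -/
abbrev AreaState (i : ι) := DayTime × Fin (N.σ i + 1)

/-- The state of the whole system: time of day and numbers of vehicles in all areas. -/
abbrev State := DayTime × (∀ i, Fin (N.σ i + 1))

/-- The actions of the agent of area `i`. -/
abbrev AreaAction (i : ι) := N.act i

/-- The action vectors. -/
abbrev Action := ∀ i, N.AreaAction i

/-- The part of the state that belongs to area `i`. -/
def proj (s : N.State) (i : ι) : N.AreaState i := (s.1, s.2 i)

/-- `[z]_*`: zero if `z = 0`, and one otherwise. -/
def indic (z : ℤ) : ℝ := if z = 0 then 0 else 1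

/-- The reward of area `i`: state `s`, action `a`, number of failures `f`. -/
def areaReward (i : ι) (s : N.AreaState i) (a : N.AreaAction i) (f : ℕ) : ℝ :=
  -(N.α * N.φ (N.κ i) * indic a) - f - N.ξ * N.ℓ i s.2 (N.μ i s.1)

/-- The single-area decision process of area `i`. -/
def areaMDP (i : ι) : MDP (N.AreaState i) (N.AreaAction i) where
  p s a := (N.law i s.1 s.2 a).toMeasure.map fun y => ((s.1.next, y.1), N.areaReward i s a y.2)
  isProb _ _ := Measure.isProbabilityMeasure_map (Measurable.of_discrete).aemeasurable
  γ := N.γ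
  γ_nonneg := N.γ_nonneg
  γ_lt_one := N.γ_lt_one

variable [Fintype ι]

/-- The rebalancing cost: the areas are grouped by category. -/
def reb (a : N.Action) : ℝ :=
  N.α * ∑ m : Fin N.M, N.φ m * ∑ i with N.κ i = m, indic (a i)

/-- The global reward: state `s`, action vector `a`, numbers of failures `f`. -/
def globalReward (s : N.State) (a : N.Action) (f : ι → ℕ) : ℝ :=
  -N.reb a - ∑ i, (f i : ℝ) - N.ξ * ∑ i, N.ℓ i (s.2 i) (N.μ i s.1)

/-- The joint law of the next state of the system and of the failures in all areas, given the
present state and the action vector: the areas evolve independently of each other, and each one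
is only affected by its own action. -/
def jointLaw (s : N.State) (a : N.Action) : Measure (N.State × (ι → ℕ)) :=
  (Measure.pi fun i => (N.law i s.1 (s.2 i) (a i)).toMeasure).map
    fun y => ((s.1.next, fun i => (y i).1), fun i => (y i).2)

instance (s : N.State) (a : N.Action) : IsProbabilityMeasure (N.jointLaw s a) :=
  Measure.isProbabilityMeasure_map (Measurable.of_discrete).aemeasurable

/-- The multi-agent decision process with the global reward. -/
def jointMDP : MDP N.State N.Action where
  p s a := (N.jointLaw s a).map fun y => (y.1, N.globalReward s a y.2)
  isProb _ _ := Measure.isProbabilityMeasure_map (Measurable.of_discrete).aemeasurable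
  γ := N.γ
  γ_nonneg := N.γ_nonneg
  γ_lt_one := N.γ_lt_one

/-- The combination of deterministic single-area policies: agent `i` acts on its own state. -/
def combine (d : ∀ i, N.AreaState i → N.AreaAction i) : N.State → N.Action :=
  fun s i => d i (N.proj s i)

/-- The combination of randomised single-area policies: the agents act independently, agent `i`
on its own state. -/
def combinePolicy [DecidableEq ι] (π : ∀ i, MDP.Policy (N.AreaState i) (N.AreaAction i)) :
    MDP.Policy N.State N.Action := fun s =>
  PMF.ofFintype (fun a => ∏ i, π i (N.proj s i) (a i)) <| by
    rw [← Fintype.prod_sum]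
    refine Finset.prod_eq_one fun i _ => ?_
    have h := (π i (N.proj s i)).tsum_coe
    rwa [tsum_fintype] at h

/-- The data of distributed learning in the system, on a probability space `(Ω, P)`: the
state, the action vector and the failures at each rebalancing instant, and the learning rates of
the agents. The actions may be chosen in any way that does not look into the future. -/
structure Run {Ω : Type*} [mΩ : MeasurableSpace Ω] (P : Measure Ω) where
  /-- the information available at each instant, after the choice of the actions -/
  ℱ : Filtration ℕ mΩ
  state : ℕ → Ω → N.State
  action : ℕ → Ω → N.Action
  /-- `fail t ω i` is the number of failures in area `i` between the instants `t` and `t + 1` -/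
  fail : ℕ → Ω → ι → ℕ
  /-- learning rate of each agent -/
  rate : ι → ℕ → Ω → ℝ
  state_meas : ∀ t, Measurable[ℱ t] (state t)
  action_meas : ∀ t, Measurable[ℱ t] (action t)
  fail_meas : ∀ t, Measurable[ℱ (t + 1)] (fail t)
  rate_meas : ∀ i t, Measurable[ℱ t] (rate i t)
  rate_nonneg : ∀ i t ω, 0 ≤ rate i t ω
  rate_le_one : ∀ i t ω, rate i t ω ≤ 1
  /-- given the past, the next state and the failures follow the dynamics of the system -/
  dynamics : ∀ t, ∀ B : Set (N.State × (ι → ℕ)), MeasurableSet B →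
    P[((fun ω => (state (t + 1) ω, fail t ω)) ⁻¹' B).indicator (fun _ => (1 : ℝ)) | ℱ t]
      =ᵐ[P] fun ω => (N.jointLaw (state t ω) (action t ω)).real B

namespace Run

variable {N} {Ω : Type*} [MeasurableSpace Ω] {P : Measure Ω} (D : N.Run P)

/-- The table of agent `i` after `t` steps of single-agent Q-learning on the local states, actions
and rewards of area `i`, with initial table `q₀`. -/
def Q (i : ι) (q₀ : N.AreaState i → N.AreaAction i → ℝ) :
    ℕ → Ω → N.AreaState i → N.AreaAction i → ℝ
  | 0, _ => q₀
  | t + 1, ω =>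
    qUpdate N.γ (D.rate i t ω) (Q i q₀ t ω) (N.proj (D.state t ω) i) (D.action t ω i)
      (N.areaReward i (N.proj (D.state t ω) i) (D.action t ω i) (D.fail t ω i))
      (N.proj (D.state (t + 1) ω) i)

open Classical in
/-- The usual conditions of single-agent Q-learning, for every agent, almost surely: the learning
rates are square summable, and the sum of the learning rates over the visits to any fixed
state-action pair diverges. -/
def RobbinsMonro : Prop :=
  ∀ i, ∀ᵐ ω ∂P, (Summable fun t => D.rate i t ω ^ 2) ∧
    ∀ (s : N.AreaState i) (a : N.AreaAction i),
      Tendsto (fun T => ∑ t ∈ Finset.range T,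
        if N.proj (D.state t ω) i = s ∧ D.action t ω i = a then D.rate i t ω else 0) atTop atTop

end Run

end SharingSystem

end

/-! Separability rests on linearity. Grouping the rebalancing costs by category only reorders a sum,
so the global reward is the sum of the local ones. The marginal of the joint law on area `i` is the
law of that area under its own state and action. Hence the one-step look-ahead of `∑ i, v i (s_i)`
is the sum of the local look-aheads (`jointMDP_lookahead_sum`). A maximum of such a sum over a
product of action sets separates, so the sum of the local optimal values satisfies the joint Bellman
optimality equation. A solution of that equation dominates every policy value and is attained by a
greedy policy, so it is the optimal value (`optValue_eq`). Policies are compared through one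
criterion: optimality means playing only actions with `optQ s a = optValue s`. In the joint problem
both sides are sums of local terms with `optQ ≤ optValue` termwise, so equality holds exactly when
it holds in every area.

For learning, each agent is treated as a single asynchronous Q-learner along the common filtration.
Its error is a running average of a sup-norm `γ`-contraction plus martingale noise. The noise,
weighted by the step sizes, has almost surely convergent partial sums (`ae_exists_tendsto_sum`), so
its running average vanishes, and a pathwise argument shrinks the error geometrically
(`tendsto_zero_of_contraction`). The noise from the next state is multiplied by table values, so the
tables must be bounded first. `exists_abs_Q_le` avoids circularity by counting only the failures as
noise and keeping the sampled next-state value inside the drift, where it is bounded by `γ` times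
the sup norm of the table. -/

noncomputable section

/-! ### One-step laws, look-ahead and the comparison principle -/

namespace MDP

variable {S A : Type*} [MeasurableSpace S]

section StepLaw

variable [Fintype A]

theorem integrable_stepLaw (M : MDP S A) (π : Policy S A) (s : S) {f : S × ℝ → ℝ}
    (hf : ∀ a, Integrable f (M.p s a)) : Integrable f (M.stepLaw π s) := by
  rw [stepLaw, integrable_finsetSum_measure]
  exact fun a _ => (hf a).smul_measure ((π s).apply_ne_top a)

theorem integral_stepLaw (M : MDP S A) (π : Policy S A) (s : S) {f : S × ℝ → ℝ}
    (hf : ∀ a, Integrable f (M.p s a)) :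
    ∫ x, f x ∂(M.stepLaw π s) = ∑ a, (π s a).toReal * ∫ x, f x ∂(M.p s a) := by
  rw [stepLaw, integral_finsetSum_measure]
  · simp
  · exact fun a _ => (hf a).smul_measure ((π s).apply_ne_top a)

omit [MeasurableSpace S] in
theorem sum_policy_toReal (π : Policy S A) (s : S) : ∑ a, (π s a).toReal = 1 := by
  rw [← ENNReal.toReal_sum fun a _ => (π s).apply_ne_top a]
  have h := (π s).tsum_coe
  rw [tsum_fintype] at h
  simp [h]

end StepLaw

/-- The rewards have finite expectations. -/
def IntegrableReward (M : MDP S A) : Prop := ∀ s a, Integrable (fun x => x.2) (M.p s a)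

/-- The action value of a one-step look-ahead with final values `v`. -/
def lookahead (M : MDP S A) (v : S → ℝ) (s : S) (a : A) : ℝ :=
  ∫ x, (x.2 + M.γ * v x.1) ∂(M.p s a)

theorem optQ_eq_lookahead [Fintype A] [Countable S] [MeasurableSingletonClass S] (M : MDP S A) :
    M.optQ = M.lookahead M.optValue := rfl

variable [Finite S] [MeasurableSingletonClass S]

theorem integrable_comp_fst (f : S → ℝ) (μ : Measure (S × ℝ)) [IsFiniteMeasure μ] :
    Integrable (fun x : S × ℝ => f x.1) μ :=
  (Integrable.of_finite (μ := μ.map Prod.fst) (f := f)).comp_measurable measurable_fst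

theorem IntegrableReward.integrable_lookahead {M : MDP S A} (hM : M.IntegrableReward)
    (v : S → ℝ) (s : S) (a : A) : Integrable (fun x => x.2 + M.γ * v x.1) (M.p s a) := by
  have := M.isProb s a
  exact (hM s a).add ((integrable_comp_fst v _).const_mul _)

theorem IntegrableReward.lookahead_eq {M : MDP S A} (hM : M.IntegrableReward)
    (v : S → ℝ) (s : S) (a : A) :
    M.lookahead v s a = ∫ x, x.2 ∂(M.p s a) + M.γ * ∫ x, v x.1 ∂(M.p s a) := by
  have := M.isProb s a
  rw [lookahead, integral_add (hM s a) ((integrable_comp_fst v _).const_mul _),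
    integral_const_mul]

/-- Monotonicity and the discounting of constants combined: the one-sided form of the contraction
property that `le_of_gap_contracts` consumes. -/
theorem IntegrableReward.lookahead_le {M : MDP S A} (hM : M.IntegrableReward) {u v : S → ℝ}
    {m : ℝ} (h : ∀ s, u s ≤ v s + m) (s : S) (a : A) :
    M.lookahead u s a ≤ M.lookahead v s a + M.γ * m := by
  have := M.isProb s a
  rw [hM.lookahead_eq, hM.lookahead_eq, add_assoc, ← mul_add]
  have h1 : ∫ x, u x.1 ∂(M.p s a) ≤ ∫ x, (v x.1 + m) ∂(M.p s a) :=
    integral_mono (integrable_comp_fst u _)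
      ((integrable_comp_fst v _).add (integrable_const m)) fun x => h x.1
  rw [integral_add (integrable_comp_fst v _) (integrable_const m)] at h1
  simp only [integral_const, probReal_univ, one_smul] at h1
  have := mul_le_mul_of_nonneg_left h1 M.γ_nonneg
  linarith

/-- Comparison principle: if an upper bound of the gap between `u` and `v` can always be
shrunk by the factor `c < 1`, then `u ≤ v`. -/
theorem le_of_gap_contracts {S : Type*} [Finite S] {u v : S → ℝ} {c : ℝ} (hc : c < 1)
    (h : ∀ m, (∀ s, u s ≤ v s + m) → ∀ s, u s ≤ v s + c * m) (s : S) : u s ≤ v s := by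
  have : Nonempty S := ⟨s⟩
  -- At a state of largest gap the hypothesis bounds the gap by `c` times itself, so it is not
  -- positive.
  obtain ⟨s₀, hs₀⟩ := Finite.exists_max fun s => u s - v s
  have h1 := h (u s₀ - v s₀) (fun s => by linarith [hs₀ s]) s₀
  have h2 : u s₀ - v s₀ ≤ 0 := by nlinarith
  linarith [hs₀ s]

/-! ### Trajectories, the value series and the Bellman equation -/

section Value

variable [Fintype A]

theorem integral_trajLaw_zero (M : MDP S A) (π : Policy S A) (s : S) (f : S → ℝ) :
    ∫ ω, f (ω 0).1 ∂(M.trajLaw π s) = f s := by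
  have h : (M.trajLaw π s).map (Preorder.frestrictLe (π := fun _ => S × ℝ) 0) =
      (Measure.dirac (s, (0 : ℝ))).map
        (MeasurableEquiv.piUnique (fun _ : Finset.Iic 0 => S × ℝ)).symm := by
    rw [trajLaw, Kernel.trajMeasure, Measure.map_comp _ _ (by fun_prop),
      Kernel.traj_map_frestrictLe, Kernel.partialTraj_self, Measure.id_comp]
  have hm : Measurable fun x : (i : Finset.Iic 0) → S × ℝ => f (x ⟨0, by simp⟩).1 :=
    (Measurable.of_discrete (f := f)).comp (measurable_fst.comp (measurable_pi_apply _))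
  calc ∫ ω, f (ω 0).1 ∂(M.trajLaw π s)
      = ∫ x, f (x ⟨0, by simp⟩).1
          ∂((M.trajLaw π s).map (Preorder.frestrictLe (π := fun _ => S × ℝ) 0)) := by
        rw [integral_map (by fun_prop) hm.aestronglyMeasurable]
        rfl
    _ = f s := by
        rw [h, integral_map (by fun_prop) hm.aestronglyMeasurable]
        exact integral_dirac' _ _ (hm.comp (MeasurableEquiv.measurable _)).stronglyMeasurable

instance (M : MDP S A) (π : Policy S A) (s : S) : IsProbabilityMeasure (M.trajLaw π s) := by
  unfold trajLaw
  infer_instance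

theorem integrable_trajLaw_state (M : MDP S A) (π : Policy S A) (s : S) (n : ℕ) (f : S → ℝ) :
    Integrable (fun ω => f (ω n).1) (M.trajLaw π s) := by
  obtain ⟨C, hC⟩ := Finite.exists_le fun s => ‖f s‖
  have hm : Measurable fun ω : ℕ → S × ℝ => f (ω n).1 :=
    (Measurable.of_discrete (f := f)).comp (measurable_fst.comp (measurable_pi_apply n))
  exact Integrable.of_bound hm.aestronglyMeasurable C (ae_of_all _ fun ω => hC _)

/-- The Markov property at one instant: the law of the past up to `n` composed with the kernel is
the law of the past together with the next coordinate. Integrability holds because the conditional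
mean of `‖f‖` depends only on the state, which takes finitely many values. -/
theorem trajLaw_succ (M : MDP S A) (π : Policy S A) (s : S) (n : ℕ) {f : S × ℝ → ℝ}
    (hf : Measurable f) (hi : ∀ s a, Integrable f (M.p s a)) :
    Integrable (fun ω => f (ω (n + 1))) (M.trajLaw π s) ∧
    ∫ ω, f (ω (n + 1)) ∂(M.trajLaw π s) =
      ∫ ω, (∫ x, f x ∂(M.stepLaw π (ω n).1)) ∂(M.trajLaw π s) := by
  let κ : (n : ℕ) → Kernel ((i : Finset.Iic n) → S × ℝ) (S × ℝ) :=
    fun n => (M.stepKernel π).comap (fun x => x ⟨n, by simp⟩) (measurable_pi_apply _)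
  have hκ : ∀ x, κ n x = M.stepLaw π (x ⟨n, by simp⟩).1 := fun x => rfl
  have hmap : (M.trajLaw π s).map (Preorder.frestrictLe (π := fun _ => S × ℝ) n) ⊗ₘ κ n =
      (M.trajLaw π s).map
        (fun x => (Preorder.frestrictLe (π := fun _ => S × ℝ) n x, x (n + 1))) :=
    Kernel.map_frestrictLe_trajMeasure_compProd_eq_map_trajMeasure (X := fun _ => S × ℝ)
      (κ := κ) (μ₀ := Measure.dirac (s, 0)) (a := n)
  have hfm : Measurable fun x : ((i : Finset.Iic n) → S × ℝ) × (S × ℝ) => f x.2 :=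
    hf.comp measurable_snd
  have hint : Integrable (fun x : ((i : Finset.Iic n) → S × ℝ) × (S × ℝ) => f x.2)
      ((M.trajLaw π s).map (Preorder.frestrictLe (π := fun _ => S × ℝ) n) ⊗ₘ κ n) := by
    rw [Measure.integrable_compProd_iff hfm.aestronglyMeasurable]
    refine ⟨ae_of_all _ fun x => ?_, ?_⟩
    · rw [hκ]
      exact M.integrable_stepLaw π _ (hi _)
    · simp only [hκ]
      have h1 := M.integrable_trajLaw_state π s n fun s' => ∫ y, ‖f y‖ ∂(M.stepLaw π s')
      rw [integrable_map_measure _ (by fun_prop)]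
      · exact h1
      · exact ((Measurable.of_discrete
          (f := fun s' => ∫ y, ‖f y‖ ∂(M.stepLaw π s'))).comp
            (measurable_fst.comp (measurable_pi_apply _))).aestronglyMeasurable
  constructor
  · rw [hmap, integrable_map_measure hfm.aestronglyMeasurable (by fun_prop)] at hint
    exact hint
  · have h2 := Measure.integral_compProd hint
    rw [hmap, integral_map (by fun_prop) hfm.aestronglyMeasurable] at h2
    simp only [hκ] at h2
    rw [h2, integral_map (by fun_prop)]
    · rfl
    · exact ((Measurable.of_discrete (f := fun s' => ∫ y, f y ∂(M.stepLaw π s'))).comp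
        (measurable_fst.comp (measurable_pi_apply _))).aestronglyMeasurable

/-- The expected final value after one step. -/
def stepMean (M : MDP S A) (π : Policy S A) (f : S → ℝ) (s : S) : ℝ :=
  ∫ x, f x.1 ∂(M.stepLaw π s)

theorem integral_trajLaw_state (M : MDP S A) (π : Policy S A) (s : S) (n : ℕ) (f : S → ℝ) :
    ∫ ω, f (ω n).1 ∂(M.trajLaw π s) = (M.stepMean π)^[n] f s := by
  induction n generalizing f with
  | zero => exact M.integral_trajLaw_zero π s f
  | succ n ih =>
    rw [Function.iterate_succ_apply, ← ih]
    have hf : Measurable fun x : S × ℝ => f x.1 :=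
      (Measurable.of_discrete (f := f)).comp measurable_fst
    exact (M.trajLaw_succ π s n hf fun s a =>
      have := M.isProb s a
      integrable_comp_fst f _).2

/-- The expected reward of one step. -/
def stepReward (M : MDP S A) (π : Policy S A) (s : S) : ℝ := ∫ x, x.2 ∂(M.stepLaw π s)

theorem abs_stepMean_iterate_le (M : MDP S A) (π : Policy S A) {f : S → ℝ} {C : ℝ}
    (hf : ∀ s, |f s| ≤ C) (n : ℕ) (s : S) : |(M.stepMean π)^[n] f s| ≤ C := by
  rw [← integral_trajLaw_state, ← Real.norm_eq_abs]
  refine (norm_integral_le_of_norm_le_const (C := C) (ae_of_all _ fun ω => hf _)).trans ?_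
  simp

/-- Finiteness of the state space bounds the expected absolute reward uniformly in time, so the
discounted series is dominated by a geometric one and may be integrated term by term. -/
theorem IntegrableReward.value_eq_tsum {M : MDP S A} (hM : M.IntegrableReward)
    (π : Policy S A) (s : S) :
    M.value π s = ∑' k, M.γ ^ k * (M.stepMean π)^[k] (M.stepReward π) s := by
  have hr (n : ℕ) := M.trajLaw_succ π s n measurable_snd hM
  have hn (n : ℕ) := M.trajLaw_succ π s n (measurable_snd.norm) fun s a => (hM s a).norm
  obtain ⟨C, hC⟩ := Finite.exists_le fun s => |∫ x, ‖x.2‖ ∂(M.stepLaw π s)|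
  have h := hasSum_integral_of_summable_integral_norm (μ := M.trajLaw π s)
    (F := fun k ω => M.γ ^ k * (ω (k + 1)).2) (fun k => (hr k).1.const_mul _) ?_
  · rw [value]
    refine h.tsum_eq.symm.trans (tsum_congr fun k => ?_)
    rw [integral_const_mul, (hr k).2, ← integral_trajLaw_state]
    rfl
  · refine Summable.of_nonneg_of_le (fun k => integral_nonneg fun ω => norm_nonneg _)
      (fun k => ?_) ((summable_geometric_of_lt_one M.γ_nonneg M.γ_lt_one).mul_right C)
    have h1 : ∫ ω, ‖M.γ ^ k * (ω (k + 1)).2‖ ∂(M.trajLaw π s) =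
        M.γ ^ k * ∫ ω, ‖(ω (k + 1)).2‖ ∂(M.trajLaw π s) := by
      rw [← integral_const_mul]
      refine integral_congr_ae (ae_of_all _ fun ω => ?_)
      simp [abs_of_nonneg M.γ_nonneg]
    rw [h1]
    refine mul_le_mul_of_nonneg_left ?_ (pow_nonneg M.γ_nonneg k)
    rw [(hn k).2, M.integral_trajLaw_state π s k fun s' => ∫ x, ‖x.2‖ ∂(M.stepLaw π s')]
    exact (le_abs_self _).trans (M.abs_stepMean_iterate_le π hC k s)

/-- The Bellman equation for a fixed policy: split off the first term of the value series and take
one transition out of all the others. -/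
theorem IntegrableReward.value_eq {M : MDP S A} (hM : M.IntegrableReward)
    (π : Policy S A) (s : S) :
    M.value π s = ∑ a, (π s a).toReal * M.lookahead (M.value π) s a := by
  obtain ⟨C, hC⟩ := Finite.exists_le fun s => |M.stepReward π s|
  have hb := M.abs_stepMean_iterate_le π hC
  have hgeo := (summable_geometric_of_lt_one M.γ_nonneg M.γ_lt_one).mul_right C
  have hle (s : S) (k : ℕ) :
      ‖M.γ ^ k * (M.stepMean π)^[k] (M.stepReward π) s‖ ≤ M.γ ^ k * C := by
    rw [norm_mul, norm_pow, Real.norm_of_nonneg M.γ_nonneg]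
    exact mul_le_mul_of_nonneg_left (hb k s) (pow_nonneg M.γ_nonneg k)
  have hsum (s : S) : Summable fun k => M.γ ^ k * (M.stepMean π)^[k] (M.stepReward π) s :=
    hgeo.of_norm_bounded (hle s)
  have := M.isProbabilityMeasure_stepLaw π s
  have h := hasSum_integral_of_summable_integral_norm (μ := M.stepLaw π s)
    (F := fun k x => M.γ ^ k * (M.stepMean π)^[k] (M.stepReward π) x.1)
    (fun k => (integrable_comp_fst _ _).const_mul _) <| by
      refine Summable.of_nonneg_of_le (fun k => integral_nonneg fun ω => norm_nonneg _)
        (fun k => ?_) hgeo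
      refine (integral_mono (integrable_comp_fst
        (fun s => ‖M.γ ^ k * (M.stepMean π)^[k] (M.stepReward π) s‖) _) (integrable_const _)
          fun x => hle x.1 k).trans ?_
      simp
  simp only [← hM.value_eq_tsum, integral_const_mul] at h
  have h1 : M.value π s = M.stepReward π s + M.γ * ∫ x, M.value π x.1 ∂(M.stepLaw π s) := by
    rw [hM.value_eq_tsum π s, (hsum s).tsum_eq_zero_add, ← h.tsum_eq, ← tsum_mul_left]
    simp only [pow_zero, one_mul, Function.iterate_zero, id]
    congr 1
    refine tsum_congr fun k => ?_
    -- The outermost application of `stepMean` is the first transition of the trajectory.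
    rw [Function.iterate_succ_apply', pow_succ']
    simp only [stepMean, mul_assoc]
  rw [h1]
  have h2 := M.integral_stepLaw π s (hM.integrable_lookahead (M.value π) s)
  unfold lookahead
  rw [← h2, integral_add (M.integrable_stepLaw π s (hM s))
    ((integrable_comp_fst _ _).const_mul _), integral_const_mul]
  rfl

end Value

/-! ### The Bellman optimality equation and criteria for optimal policies -/

section Optimality

variable [Fintype A]

/-- The Bellman optimality equation. -/
def IsOptimalityFixedPoint (M : MDP S A) (V : S → ℝ) : Prop :=
  ∀ s, V s = ⨆ a, M.lookahead V s a

variable {M : MDP S A}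

omit [Finite S] [MeasurableSingletonClass S] in
theorem IsOptimalityFixedPoint.lookahead_le {V : S → ℝ} (hV : M.IsOptimalityFixedPoint V)
    (s : S) (a : A) : M.lookahead V s a ≤ V s := by
  rw [hV s]
  exact le_ciSup (Set.finite_range _).bddAbove a

/-- The Bellman optimality operator is a `γ`-contraction for the sup metric, so Banach's theorem
applies. -/
theorem IntegrableReward.exists_isOptimalityFixedPoint [Nonempty A] (hM : M.IntegrableReward) :
    ∃ V, M.IsOptimalityFixedPoint V := by
  cases nonempty_fintype S
  let T : (S → ℝ) → S → ℝ := fun v s => ⨆ a, M.lookahead v s a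
  have hT : ∀ u v : S → ℝ, ∀ s, T u s ≤ T v s + M.γ * dist u v := fun u v s => by
    refine ciSup_le fun a => (hM.lookahead_le (v := v) (m := dist u v) (fun s => ?_) s a).trans ?_
    · have := (abs_le.1 ((Real.dist_eq _ _).symm.le.trans (dist_le_pi_dist u v s))).2
      linarith
    · exact add_le_add_left (le_ciSup (f := fun a => M.lookahead v s a)
        (Set.finite_range _).bddAbove a) _
  have hc : ContractingWith ⟨M.γ, M.γ_nonneg⟩ T := by
    refine ⟨M.γ_lt_one, LipschitzWith.of_dist_le_mul fun u v => ?_⟩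
    refine (dist_pi_le_iff (mul_nonneg M.γ_nonneg dist_nonneg)).2 fun s => ?_
    rw [Real.dist_eq, abs_le]
    change -(M.γ * dist u v) ≤ _ ∧ _ ≤ M.γ * dist u v
    have h1 := hT u v s
    have h2 := hT v u s
    rw [dist_comm] at h2
    constructor <;> linarith
  exact ⟨hc.fixedPoint T, fun s => (congrFun hc.fixedPoint_isFixedPt s).symm⟩

theorem IntegrableReward.value_le (hM : M.IntegrableReward) {V : S → ℝ}
    (hV : M.IsOptimalityFixedPoint V) (π : Policy S A) (s : S) : M.value π s ≤ V s := by
  refine le_of_gap_contracts M.γ_lt_one (fun m hm s => ?_) s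
  rw [hM.value_eq π s]
  calc ∑ a, (π s a).toReal * M.lookahead (M.value π) s a
      ≤ ∑ a, (π s a).toReal * (V s + M.γ * m) := by
        refine Finset.sum_le_sum fun a _ => mul_le_mul_of_nonneg_left ?_ ENNReal.toReal_nonneg
        exact (hM.lookahead_le hm s a).trans (add_le_add_left (hV.lookahead_le s a) _)
    _ = V s + M.γ * m := by rw [← Finset.sum_mul, sum_policy_toReal, one_mul]

/-- If the values agree, the Bellman equation says that a weighted mean of the nonnegative gaps `V s
- lookahead V s a` is zero, so they vanish wherever the weight does not. Conversely, if they vanish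
on the support, `V` satisfies the Bellman equation of `π` and comparison gives equality. -/
theorem IntegrableReward.value_eq_iff (hM : M.IntegrableReward) {V : S → ℝ}
    (hV : M.IsOptimalityFixedPoint V) (π : Policy S A) :
    (∀ s, M.value π s = V s) ↔ ∀ s a, π s a ≠ 0 → M.lookahead V s a = V s := by
  have hsum (s : S) : ∑ a, (π s a).toReal * (V s - M.lookahead V s a) =
      V s - ∑ a, (π s a).toReal * M.lookahead V s a := by
    simp only [mul_sub, Finset.sum_sub_distrib, ← Finset.sum_mul, sum_policy_toReal, one_mul]
  constructor
  · intro h s a ha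
    have h1 := hM.value_eq π s
    rw [funext h] at h1
    have h2 := hsum s
    rw [← h1, sub_self, Finset.sum_eq_zero_iff_of_nonneg fun a _ =>
      mul_nonneg ENNReal.toReal_nonneg (sub_nonneg.2 (hV.lookahead_le s a))] at h2
    have h3 := (mul_eq_zero.1 (h2 a (Finset.mem_univ a))).resolve_left
      (ENNReal.toReal_ne_zero.2 ⟨ha, (π s).apply_ne_top a⟩)
    linarith
  · intro h s
    refine le_antisymm (hM.value_le hV π s) (le_of_gap_contracts M.γ_lt_one (fun m hm s => ?_) s)
    have h0 : ∑ a, (π s a).toReal * (V s - M.lookahead V s a) = 0 :=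
      Finset.sum_eq_zero fun a _ => by
        by_cases ha : π s a = 0
        · simp [ha]
        · simp [h s a ha]
    rw [hM.value_eq π s]
    calc V s = ∑ a, (π s a).toReal * M.lookahead V s a := by linarith [hsum s]
      _ ≤ ∑ a, (π s a).toReal * (M.lookahead (M.value π) s a + M.γ * m) :=
        Finset.sum_le_sum fun a _ =>
          mul_le_mul_of_nonneg_left (hM.lookahead_le hm s a) ENNReal.toReal_nonneg
      _ = _ := by
        simp only [mul_add, Finset.sum_add_distrib, ← Finset.sum_mul, sum_policy_toReal, one_mul]

theorem IntegrableReward.value_pure_eq_iff (hM : M.IntegrableReward) {V : S → ℝ}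
    (hV : M.IsOptimalityFixedPoint V) (d : S → A) :
    (∀ s, M.value (pure d) s = V s) ↔ ∀ s, M.lookahead V s (d s) = V s := by
  classical
  rw [hM.value_eq_iff hV]
  refine forall_congr' fun s => ⟨fun h => h _ ?_, fun h a ha => ?_⟩
  · simp [pure]
  · have : a = d s := by simpa [pure] using ha
    rw [this, h]

omit [Finite S] [MeasurableSingletonClass S] in
theorem IsOptimalityFixedPoint.exists_greedy [Nonempty A] {V : S → ℝ}
    (hV : M.IsOptimalityFixedPoint V) : ∃ d : S → A, ∀ s, M.lookahead V s (d s) = V s := by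
  choose d hd using fun s => exists_eq_ciSup_of_finite (f := fun a => M.lookahead V s a)
  exact ⟨d, fun s => (hd s).trans (hV s).symm⟩

variable [Nonempty A]

/-- A fixed point bounds all policy values and is the value of its own greedy policy, hence is their
supremum. To compute the optimal value it therefore suffices to exhibit a fixed point. -/
theorem IntegrableReward.optValue_eq (hM : M.IntegrableReward) {V : S → ℝ}
    (hV : M.IsOptimalityFixedPoint V) : M.optValue = V := by
  obtain ⟨d, hd⟩ := hV.exists_greedy
  have hd' := (hM.value_pure_eq_iff hV d).2 hd
  have : Nonempty (Policy S A) := ⟨pure d⟩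
  funext s
  refine le_antisymm (ciSup_le fun π => hM.value_le hV π s) ?_
  rw [← hd' s]
  exact le_ciSup (f := fun π => M.value π s)
    ⟨V s, Set.forall_mem_range.2 fun π => hM.value_le hV π s⟩ (pure d)

theorem IntegrableReward.isOptimalityFixedPoint_optValue (hM : M.IntegrableReward) :
    M.IsOptimalityFixedPoint M.optValue := by
  obtain ⟨V, hV⟩ := hM.exists_isOptimalityFixedPoint
  rwa [hM.optValue_eq hV]

theorem IntegrableReward.optQ_le (hM : M.IntegrableReward) (s : S) (a : A) :
    M.optQ s a ≤ M.optValue s :=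
  hM.isOptimalityFixedPoint_optValue.lookahead_le s a

theorem IntegrableReward.optValue_eq_iSup (hM : M.IntegrableReward) (s : S) :
    M.optValue s = ⨆ a, M.optQ s a :=
  hM.isOptimalityFixedPoint_optValue s

theorem IntegrableReward.exists_optQ_eq (hM : M.IntegrableReward) :
    ∃ d : S → A, ∀ s, M.optQ s (d s) = M.optValue s :=
  hM.isOptimalityFixedPoint_optValue.exists_greedy

theorem IntegrableReward.isOptimal_iff_value_eq (hM : M.IntegrableReward) (π : Policy S A) :
    M.IsOptimal π ↔ ∀ s, M.value π s = M.optValue s := by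
  have hV := hM.isOptimalityFixedPoint_optValue
  obtain ⟨d, hd⟩ := hV.exists_greedy
  have hd' := (hM.value_pure_eq_iff hV d).2 hd
  refine ⟨fun h s => le_antisymm (hM.value_le hV π s) ?_, fun h π' s => ?_⟩
  · rw [← hd' s]
    exact h _ s
  · rw [h s]
    exact hM.value_le hV π' s

theorem IntegrableReward.isOptimal_iff (hM : M.IntegrableReward) (π : Policy S A) :
    M.IsOptimal π ↔ ∀ s a, π s a ≠ 0 → M.optQ s a = M.optValue s :=
  (hM.isOptimal_iff_value_eq π).trans
    (hM.value_eq_iff hM.isOptimalityFixedPoint_optValue π)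

/-- A deterministic greedy policy already attains the optimum over randomised policies, so competing
with deterministic policies is no weaker. -/
theorem IntegrableReward.solves_iff_value_eq (hM : M.IntegrableReward) (d : S → A) :
    M.Solves d ↔ ∀ s, M.value (pure d) s = M.optValue s := by
  have hV := hM.isOptimalityFixedPoint_optValue
  obtain ⟨d₀, hd⟩ := hV.exists_greedy
  have hd' := (hM.value_pure_eq_iff hV d₀).2 hd
  refine ⟨fun h s => le_antisymm (hM.value_le hV _ s) ?_, fun h π' s => ?_⟩
  · rw [← hd' s]
    exact h _ s
  · rw [h s]
    exact hM.value_le hV _ s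

theorem IntegrableReward.solves_iff (hM : M.IntegrableReward) (d : S → A) :
    M.Solves d ↔ ∀ s, M.optQ s (d s) = M.optValue s :=
  (hM.solves_iff_value_eq d).trans
    (hM.value_pure_eq_iff hM.isOptimalityFixedPoint_optValue d)

theorem IntegrableReward.solves_iff_isOptimal (hM : M.IntegrableReward) (d : S → A) :
    M.Solves d ↔ M.IsOptimal (pure d) :=
  (hM.solves_iff_value_eq d).trans (hM.isOptimal_iff_value_eq _).symm

end Optimality

end MDP

/-! ### Separability of the sharing system -/

namespace SharingSystem

variable {ι : Type*} (N : SharingSystem ι)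

instance (i : ι) : Nonempty (N.AreaAction i) := (N.act_nonempty i).to_subtype

/-- The joint law of the next state of area `i` and of its number of failures. -/
def areaLaw (i : ι) (s : N.AreaState i) (a : N.AreaAction i) : Measure (N.AreaState i × ℕ) :=
  (N.law i s.1 s.2 a).toMeasure.map fun y => ((s.1.next, y.1), y.2)

instance (i : ι) (s : N.AreaState i) (a : N.AreaAction i) :
    IsProbabilityMeasure (N.areaLaw i s a) :=
  Measure.isProbabilityMeasure_map (Measurable.of_discrete).aemeasurable

theorem areaMDP_p (i : ι) (s : N.AreaState i) (a : N.AreaAction i) :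
    (N.areaMDP i).p s a = (N.areaLaw i s a).map fun y => (y.1, N.areaReward i s a y.2) := by
  rw [areaLaw, Measure.map_map .of_discrete .of_discrete]
  rfl

theorem integrable_areaLaw_sq (i : ι) (s : N.AreaState i) (a : N.AreaAction i) :
    Integrable (fun y => (y.2 : ℝ) ^ 2) (N.areaLaw i s a) := by
  rw [areaLaw, integrable_map_measure .of_discrete .of_discrete]
  exact N.failures_sq i s.1 s.2 a

theorem integrable_areaLaw_failures (i : ι) (s : N.AreaState i) (a : N.AreaAction i) :
    Integrable (fun y => (y.2 : ℝ)) (N.areaLaw i s a) := by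
  refine (N.integrable_areaLaw_sq i s a).mono' .of_discrete (ae_of_all _ fun y => ?_)
  rw [Real.norm_of_nonneg (Nat.cast_nonneg _)]
  exact_mod_cast Nat.le_self_pow two_ne_zero y.2

theorem integrable_areaLaw_reward (i : ι) (s : N.AreaState i) (a : N.AreaAction i) :
    Integrable (fun y => N.areaReward i s a y.2) (N.areaLaw i s a) := by
  unfold areaReward
  exact ((integrable_const _).sub (N.integrable_areaLaw_failures i s a)).sub (integrable_const _)

theorem integrable_areaLaw_state (i : ι) (s : N.AreaState i) (a : N.AreaAction i)
    (v : N.AreaState i → ℝ) : Integrable (fun y => v y.1) (N.areaLaw i s a) :=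
  (Integrable.of_finite (μ := (N.areaLaw i s a).map Prod.fst) (f := v)).comp_measurable
    measurable_fst

theorem integrable_areaLaw_lookahead (i : ι) (s : N.AreaState i) (a : N.AreaAction i)
    (v : N.AreaState i → ℝ) :
    Integrable (fun y => N.areaReward i s a y.2 + N.γ * v y.1) (N.areaLaw i s a) :=
  (N.integrable_areaLaw_reward i s a).add ((N.integrable_areaLaw_state i s a v).const_mul _)

theorem areaMDP_integrableReward (i : ι) : (N.areaMDP i).IntegrableReward := fun s a => by
  rw [areaMDP_p, integrable_map_measure (by fun_prop) .of_discrete]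
  exact N.integrable_areaLaw_reward i s a

theorem areaMDP_lookahead (i : ι) (v : N.AreaState i → ℝ) (s : N.AreaState i)
    (a : N.AreaAction i) : (N.areaMDP i).lookahead v s a =
      ∫ y, (N.areaReward i s a y.2 + N.γ * v y.1) ∂(N.areaLaw i s a) := by
  rw [MDP.lookahead, areaMDP_p, integral_map .of_discrete]
  · rfl
  · exact (measurable_snd.add
      (((Measurable.of_discrete (f := v)).comp measurable_fst).const_mul _)).aestronglyMeasurable

/-- Transfers statements about all system states back to all local states of one area; the other
areas are left empty. -/
theorem exists_proj_eq [DecidableEq ι] (i : ι) (s : N.AreaState i) : ∃ s' : N.State, N.proj s' i = s :=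
  ⟨(s.1, Function.update 0 i s.2), by simp [proj]⟩

variable [Fintype ι]

theorem jointLaw_map_area (s : N.State) (a : N.Action) (i : ι) :
    (N.jointLaw s a).map (fun y => (N.proj y.1 i, y.2 i)) = N.areaLaw i (N.proj s i) (a i) := by
  have h := (measurePreserving_eval (fun i => (N.law i s.1 (s.2 i) (a i)).toMeasure) i).map_eq
  rw [jointLaw, Measure.map_map .of_discrete .of_discrete, areaLaw]
  simp only [proj] at h ⊢
  rw [← h, Measure.map_map .of_discrete .of_discrete]
  rfl

theorem integrable_jointLaw_area (s : N.State) (a : N.Action) (i : ι)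
    {g : N.AreaState i × ℕ → ℝ} (hg : Integrable g (N.areaLaw i (N.proj s i) (a i))) :
    Integrable (fun y => g (N.proj y.1 i, y.2 i)) (N.jointLaw s a) := by
  rw [← jointLaw_map_area, integrable_map_measure .of_discrete .of_discrete] at hg
  exact hg

theorem integral_jointLaw_area (s : N.State) (a : N.Action) (i : ι) (g : N.AreaState i × ℕ → ℝ) :
    ∫ y, g (N.proj y.1 i, y.2 i) ∂(N.jointLaw s a) =
      ∫ y, g y ∂(N.areaLaw i (N.proj s i) (a i)) := by
  rw [← jointLaw_map_area, integral_map .of_discrete .of_discrete]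

theorem globalReward_eq_sum (s : N.State) (a : N.Action) (f : ι → ℕ) :
    N.globalReward s a f = ∑ i, N.areaReward i (N.proj s i) (a i) (f i) := by
  have h : N.reb a = ∑ i, N.α * N.φ (N.κ i) * indic (a i) := by
    -- The categories are the fibres of `κ`, on each of which `φ (κ i)` is constant.
    rw [reb, Finset.mul_sum, ← Finset.sum_fiberwise Finset.univ N.κ]
    refine Finset.sum_congr rfl fun m _ => ?_
    rw [← mul_assoc, Finset.mul_sum]
    refine Finset.sum_congr rfl fun i hi => ?_
    rw [(Finset.mem_filter.1 hi).2]
  simp only [globalReward, areaReward, h, Finset.sum_sub_distrib, Finset.sum_neg_distrib,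
    Finset.mul_sum, proj]

theorem jointMDP_p (s : N.State) (a : N.Action) :
    N.jointMDP.p s a = (N.jointLaw s a).map fun y => (y.1, N.globalReward s a y.2) := rfl

theorem jointMDP_integrableReward : N.jointMDP.IntegrableReward := fun s a => by
  rw [jointMDP_p, integrable_map_measure measurable_snd.aestronglyMeasurable .of_discrete]
  simp only [Function.comp_def, globalReward_eq_sum]
  exact integrable_finsetSum _ fun i _ =>
    
    N.integrable_jointLaw_area s a i (g := fun y => N.areaReward i (N.proj s i) (a i) y.2)
      (N.integrable_areaLaw_reward i _ _)

theorem jointMDP_lookahead_sum (v : ∀ i, N.AreaState i → ℝ) (s : N.State) (a : N.Action) :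
    N.jointMDP.lookahead (fun s => ∑ i, v i (N.proj s i)) s a =
      ∑ i, (N.areaMDP i).lookahead (v i) (N.proj s i) (a i) := by
  rw [MDP.lookahead, jointMDP_p, integral_map .of_discrete]
  · change ∫ y, (N.globalReward s a y.2 + N.γ * ∑ i, v i (N.proj y.1 i)) ∂(N.jointLaw s a) = _
    simp only [areaMDP_lookahead, globalReward_eq_sum, Finset.mul_sum, ← Finset.sum_add_distrib]
    rw [integral_finsetSum]
    · refine Finset.sum_congr rfl fun i _ => ?_
      exact N.integral_jointLaw_area s a i
        fun y => N.areaReward i (N.proj s i) (a i) y.2 + N.γ * v i y.1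
    · exact fun i _ =>
      N.integrable_jointLaw_area s a i
        (g := fun y => N.areaReward i (N.proj s i) (a i) y.2 + N.γ * v i y.1)
        (N.integrable_areaLaw_lookahead i _ _ _)
  · exact (measurable_snd.add (((Measurable.of_discrete
      (f := fun s => ∑ i, v i (N.proj s i))).comp measurable_fst).const_mul _)).aestronglyMeasurable

theorem jointMDP_isOptimalityFixedPoint : N.jointMDP.IsOptimalityFixedPoint
    fun s => ∑ i, (N.areaMDP i).optValue (N.proj s i) := fun s => by
  simp only [jointMDP_lookahead_sum, ← MDP.optQ_eq_lookahead]
  choose d hd using fun i => (N.areaMDP_integrableReward i).exists_optQ_eq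
  refine le_antisymm ?_ (ciSup_le fun a => Finset.sum_le_sum fun i _ =>
    (N.areaMDP_integrableReward i).optQ_le _ _)
  -- The local maximisers together form one action vector, which attains the sum of the local
  -- maxima.
  simp only [← hd]
  exact le_ciSup (f := fun a : N.Action => ∑ i, (N.areaMDP i).optQ (N.proj s i) (a i))
    (Set.finite_range _).bddAbove (N.combine d s)

variable [DecidableEq ι]

theorem jointMDP_optValue (s : N.State) :
    N.jointMDP.optValue s = ∑ i, (N.areaMDP i).optValue (N.proj s i) :=
  congrFun (N.jointMDP_integrableReward.optValue_eq N.jointMDP_isOptimalityFixedPoint) s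

theorem jointMDP_optQ (s : N.State) (a : N.Action) :
    N.jointMDP.optQ s a = ∑ i, (N.areaMDP i).optQ (N.proj s i) (a i) := by
  rw [MDP.optQ_eq_lookahead, funext N.jointMDP_optValue, jointMDP_lookahead_sum]
  rfl

theorem jointMDP_optQ_eq_optValue_iff (s : N.State) (a : N.Action) :
    N.jointMDP.optQ s a = N.jointMDP.optValue s ↔
      ∀ i, (N.areaMDP i).optQ (N.proj s i) (a i) = (N.areaMDP i).optValue (N.proj s i) := by
  rw [jointMDP_optQ, jointMDP_optValue, Finset.sum_eq_sum_iff_of_le fun i _ =>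
    (N.areaMDP_integrableReward i).optQ_le _ _]
  simp

theorem solves_combine_iff (d : ∀ i, N.AreaState i → N.AreaAction i) :
    (∀ i, (N.areaMDP i).Solves (d i)) ↔ N.jointMDP.Solves (N.combine d) := by
  simp only [N.jointMDP_integrableReward.solves_iff, (N.areaMDP_integrableReward _).solves_iff,
    jointMDP_optQ_eq_optValue_iff, combine]
  refine ⟨fun h s i => h i _, fun h i s => ?_⟩
  obtain ⟨s', rfl⟩ := N.exists_proj_eq i s
  exact h s' i

/-- The local policies must depend on `s`: a joint solution may break ties in one area according to
the state of another. -/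
theorem solves_iff_exists_combine (D : N.State → N.Action) : N.jointMDP.Solves D ↔
    ∀ s, ∃ d : ∀ i, N.AreaState i → N.AreaAction i,
      (∀ i, (N.areaMDP i).Solves (d i)) ∧ D s = N.combine d s := by
  simp only [N.jointMDP_integrableReward.solves_iff, (N.areaMDP_integrableReward _).solves_iff,
    jointMDP_optQ_eq_optValue_iff]
  refine forall_congr' fun s => ⟨fun h => ?_, ?_⟩
  · choose d hd using fun i => (N.areaMDP_integrableReward i).exists_optQ_eq
    -- A fixed local solution is overridden only at the local part of `s`, where `D` also picks an
    -- optimal action.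
    refine ⟨fun i => Function.update (d i) (N.proj s i) (D s i), fun i s' => ?_, ?_⟩
    · by_cases hs : s' = N.proj s i
      · subst hs
        simpa using h i
      · simpa [hs] using hd i s'
    · funext i
      simp [combine]
  · rintro ⟨d, hd, hD⟩ i
    rw [hD]
    exact hd i _

theorem isOptimal_combinePolicy_iff (π : ∀ i, MDP.Policy (N.AreaState i) (N.AreaAction i)) :
    (∀ i, (N.areaMDP i).IsOptimal (π i)) ↔ N.jointMDP.IsOptimal (N.combinePolicy π) := by
  simp only [N.jointMDP_integrableReward.isOptimal_iff,
    (N.areaMDP_integrableReward _).isOptimal_iff, jointMDP_optQ_eq_optValue_iff]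
  have hne (s : N.State) (a : N.Action) :
      N.combinePolicy π s a ≠ 0 ↔ ∀ i, π i (N.proj s i) (a i) ≠ 0 := by
    simp [combinePolicy, Finset.prod_eq_zero_iff]
  refine ⟨fun h s a ha i => h i _ _ ((hne s a).1 ha i), fun h i s b hb => ?_⟩
  obtain ⟨s', rfl⟩ := N.exists_proj_eq i s
  -- The other agents play actions of positive probability, so the vector with `b` in place `i` lies
  -- in the support of the product.
  choose c hc using fun j => (π j (N.proj s' j)).support_nonempty
  have h1 := h s' (Function.update c i b) ((hne _ _).2 fun j => ?_) i
  · simpa using h1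
  · by_cases hj : j = i
    · subst hj
      simpa using hb
    · simpa [hj] using hc j

end SharingSystem

namespace StochasticApproximation

/-! ### Running averages of real sequences -/

section Deterministic

variable {α : ℕ → ℝ} (h0 : ∀ t, 0 ≤ α t) (h1 : ∀ t, α t ≤ 1)
  (hα : Tendsto (fun T => ∑ t ∈ Finset.range T, α t) atTop atTop)

-- From `1 - α ≤ exp (-α)`, the product of the factors is at most `exp (-∑ α)`, which tends to zero.
include h1 hα in
theorem tendsto_zero_of_le_one_sub_mul {y : ℕ → ℝ} (hy : ∀ t, 0 ≤ y t) {T₀ : ℕ}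
    (h : ∀ t, T₀ ≤ t → y (t + 1) ≤ (1 - α t) * y t) : Tendsto y atTop (𝓝 0) := by
  set σ : ℕ → ℝ := fun T => ∑ t ∈ Finset.range T, α t with hσ
  have hle : ∀ t, T₀ ≤ t → y t ≤ y T₀ * Real.exp (σ T₀ - σ t) := fun t ht => by
    induction t, ht using Nat.le_induction with
    | base => simp
    | succ t ht ih =>
      have he : σ T₀ - σ (t + 1) = -α t + (σ T₀ - σ t) := by
        simp only [hσ, Finset.sum_range_succ]
        ring
      rw [he, Real.exp_add]
      calc y (t + 1) ≤ (1 - α t) * y t := h t ht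
        _ ≤ (1 - α t) * (y T₀ * Real.exp (σ T₀ - σ t)) :=
          mul_le_mul_of_nonneg_left ih (sub_nonneg.2 (h1 t))
        _ ≤ Real.exp (-α t) * (y T₀ * Real.exp (σ T₀ - σ t)) :=
          mul_le_mul_of_nonneg_right (Real.one_sub_le_exp_neg _)
            (mul_nonneg (hy _) (Real.exp_nonneg _))
        _ = _ := by ring
  have hlim : Tendsto (fun t => y T₀ * Real.exp (σ T₀ - σ t)) atTop (𝓝 0) := by
    rw [← mul_zero (y T₀)]
    simp only [sub_eq_add_neg]
    exact (Real.tendsto_exp_atBot.comp (tendsto_atBot_add_const_left _ (σ T₀)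
      (tendsto_neg_atTop_atBot.comp hα))).const_mul _
  exact squeeze_zero' (Eventually.of_forall hy) ((eventually_ge_atTop T₀).mono hle) hlim

-- Once `g ≤ B`, the positive part of `u - B` is multiplied by at most `1 - α t` at each step.
include h0 h1 hα in
theorem eventually_le_of_average {u g : ℕ → ℝ}
    (hu : ∀ t, u (t + 1) = (1 - α t) * u t + α t * g t) {B : ℝ} (hg : ∀ᶠ t in atTop, g t ≤ B)
    {ε : ℝ} (hε : 0 < ε) : ∀ᶠ t in atTop, u t ≤ B + ε := by
  obtain ⟨T₀, hT⟩ := eventually_atTop.1 hg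
  have hlim := tendsto_zero_of_le_one_sub_mul h1 hα (y := fun t => max (u t - B) 0)
    (fun t => le_max_right _ _) (T₀ := T₀) fun t ht => by
      have ha := sub_nonneg.2 (h1 t)
      refine max_le ?_ (mul_nonneg ha (le_max_right _ _))
      have h2 := mul_le_mul_of_nonneg_left (hT t ht) (h0 t)
      have h3 := mul_le_mul_of_nonneg_left (le_max_left (u t - B) 0) ha
      rw [hu t]
      linarith
  filter_upwards [hlim.eventually (gt_mem_nhds hε)] with t ht
  linarith [le_max_left (u t - B) 0]

include h0 h1 hα in
theorem tendsto_zero_of_average {u g : ℕ → ℝ}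
    (hu : ∀ t, u (t + 1) = (1 - α t) * u t + α t * g t) (hg : Tendsto g atTop (𝓝 0)) :
    Tendsto u atTop (𝓝 0) := by
  rw [Metric.tendsto_atTop'] at hg ⊢
  intro ε hε
  obtain ⟨T, hT⟩ := hg (ε / 3) (by positivity)
  have hg' : ∀ᶠ t in atTop, |g t| < ε / 3 := by
    filter_upwards [eventually_gt_atTop T] with t ht
    simpa using hT t ht
  have hp := eventually_le_of_average h0 h1 hα hu
    (hg'.mono fun t ht => (le_abs_self _).trans ht.le) (ε := ε / 3) (by positivity)
  have hn := eventually_le_of_average h0 h1 hα (u := fun t => -u t) (g := fun t => -g t)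
    (fun t => by rw [hu t]; ring)
    (hg'.mono fun t ht => (neg_le_abs _).trans ht.le) (ε := ε / 3) (by positivity)
  obtain ⟨T', hT'⟩ := eventually_atTop.1 (hp.and hn)
  refine ⟨T', fun t ht => ?_⟩
  have := hT' t (le_of_lt ht)
  rw [Real.dist_eq, sub_zero, abs_lt]
  constructor <;> linarith [this.1, this.2]

/-- The average of the noise `w` with step sizes `α`. -/
def noiseAverage (α w : ℕ → ℝ) : ℕ → ℝ
  | 0 => 0
  | t + 1 => (1 - α t) * noiseAverage α w t + α t * w t

include h0 h1 hα in
theorem tendsto_noiseAverage {w : ℕ → ℝ} {L : ℝ}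
    (hw : Tendsto (fun T => ∑ t ∈ Finset.range T, α t * w t) atTop (𝓝 L)) :
    Tendsto (noiseAverage α w) atTop (𝓝 0) := by
  have hL : Tendsto (fun T => ∑ t ∈ Finset.range T, α t * w t - L) atTop (𝓝 0) := by
    simpa using hw.sub_const L
  -- Subtracting the centred partial sums cancels the noise: the difference is a running average of
  -- minus those sums, which tend to zero.
  have hu := tendsto_zero_of_average h0 h1 hα
    (u := fun T => noiseAverage α w T - (∑ t ∈ Finset.range T, α t * w t - L))
    (g := fun T => -(∑ t ∈ Finset.range T, α t * w t - L))
    (fun t => by rw [noiseAverage, Finset.sum_range_succ]; ring) (by simpa using hL.neg)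
  simpa using hu.add hL

end Deterministic

/-! ### Asynchronous contractions with averaged noise -/

section Asynchronous

variable {X : Type*} [Finite X] {α : X → ℕ → ℝ} (h0 : ∀ x t, 0 ≤ α x t) (h1 : ∀ x t, α x t ≤ 1)
  (hα : ∀ x, Tendsto (fun T => ∑ t ∈ Finset.range T, α x t) atTop atTop)
  {q g w : ℕ → X → ℝ} (hq : ∀ t x, q (t + 1) x = (1 - α x t) * q t x + α x t * (g t x + w t x))
  (hw : ∀ x, ∃ L, Tendsto (fun T => ∑ t ∈ Finset.range T, α x t * w t x) atTop (𝓝 L))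
  {γ : ℝ} (hγ1 : γ < 1)

-- Subtracting the bounded noise average from `q` leaves a running average of `g` alone, which
-- cannot leave a sufficiently large interval.
include h0 h1 hα hq hw hγ1 in
theorem bounded_of_average {r : ℝ}
    (hg : ∀ t B, (∀ x, |q t x| ≤ B) → ∀ x, |g t x| ≤ r + γ * B) : ∃ B, ∀ t x, |q t x| ≤ B := by
  have hy : ∀ x, ∃ b, ∀ t, |noiseAverage (α x) (fun t => w t x) t| ≤ b := fun x => by
    obtain ⟨L, hL⟩ := hw x
    obtain ⟨b, hb⟩ :=
      (tendsto_noiseAverage (h0 x) (h1 x) (hα x) hL).abs.bddAbove_range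
    exact ⟨b, fun t => hb ⟨t, rfl⟩⟩
  choose b hb using hy
  obtain ⟨b₀, hb₀⟩ := Finite.exists_le b
  have hY : ∀ t x, |noiseAverage (α x) (fun t => w t x) t| ≤ b₀ :=
    fun t x => (hb x t).trans (hb₀ x)
  obtain ⟨q₀, hq₀⟩ := Finite.exists_le fun x => |q 0 x|
  have hγ : 0 < 1 - γ := sub_pos.2 hγ1
  -- The second entry is the least `B` with `r + γ * (B + b₀) ≤ B`, which makes `[-B, B]` invariant.
  set B := max q₀ ((r + γ * b₀) / (1 - γ)) with hB
  have hBr : r + γ * (B + b₀) ≤ B := by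
    have := (div_le_iff₀ hγ).1 (le_max_right q₀ ((r + γ * b₀) / (1 - γ)))
    rw [← hB] at this
    linarith
  have key : ∀ t x, |q t x - noiseAverage (α x) (fun t => w t x) t| ≤ B := fun t => by
    induction t with
    | zero =>
      intro x
      rw [noiseAverage, sub_zero]
      exact (hq₀ x).trans (le_max_left _ _)
    | succ t ih =>
      intro x
      have hqb : ∀ x, |q t x| ≤ B + b₀ := fun x => by
        have h2 := abs_add_le (q t x - noiseAverage (α x) (fun t => w t x) t)
          (noiseAverage (α x) (fun t => w t x) t)
        rw [sub_add_cancel] at h2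
        linarith [ih x, hY t x]
      have hgB := (hg t _ hqb x).trans hBr
      rw [hq, noiseAverage]
      have he : (1 - α x t) * q t x + α x t * (g t x + w t x) -
          ((1 - α x t) * noiseAverage (α x) (fun t => w t x) t + α x t * w t x) =
          (1 - α x t) * (q t x - noiseAverage (α x) (fun t => w t x) t) + α x t * g t x := by ring
      rw [he]
      have hx := ih x
      rw [abs_le] at hx hgB ⊢
      have ha := sub_nonneg.2 (h1 x t)
      constructor <;>
      nlinarith [mul_le_mul_of_nonneg_left hx.1 ha, mul_le_mul_of_nonneg_left hx.2 ha,
        mul_le_mul_of_nonneg_left hgB.1 (h0 x t), mul_le_mul_of_nonneg_left hgB.2 (h0 x t)]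
  refine ⟨B + b₀, fun t x => ?_⟩
  have h2 := abs_add_le (q t x - noiseAverage (α x) (fun t => w t x) t)
    (noiseAverage (α x) (fun t => w t x) t)
  rw [sub_add_cancel] at h2
  linarith [key t x, hY t x]

-- One round of improvement: without its vanishing noise average, `q` is a running average of terms
-- eventually at most `γ * B` in size. Half of `ε` pays for the averaging, half for the noise.
include h0 h1 hα hq hw in
theorem eventually_le_of_contraction
    (hg : ∀ t B, (∀ x, |q t x| ≤ B) → ∀ x, |g t x| ≤ γ * B) {B : ℝ}
    (hB : ∀ᶠ t in atTop, ∀ x, |q t x| ≤ B) {ε : ℝ} (hε : 0 < ε) :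
    ∀ᶠ t in atTop, ∀ x, |q t x| ≤ γ * B + ε := by
  rw [eventually_all]
  intro x
  obtain ⟨L, hL⟩ := hw x
  set W := noiseAverage (α x) (fun t => w t x) with hW
  have hW0 : Tendsto W atTop (𝓝 0) := tendsto_noiseAverage (h0 x) (h1 x) (hα x) hL
  have hrec : ∀ t, q (t + 1) x - W (t + 1) = (1 - α x t) * (q t x - W t) + α x t * g t x :=
    fun t => by
      rw [hq, hW, noiseAverage]
      ring
  have hgB : ∀ᶠ t in atTop, |g t x| ≤ γ * B := hB.mono fun t ht => hg t B ht x
  have hp := eventually_le_of_average (h0 x) (h1 x) (hα x) (u := fun t => q t x - W t) hrec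
    (hgB.mono fun t ht => (le_abs_self _).trans ht) (half_pos hε)
  have hn := eventually_le_of_average (h0 x) (h1 x) (hα x) (u := fun t => -(q t x - W t))
    (g := fun t => -g t x) (fun t => by rw [hrec]; ring)
    (hgB.mono fun t ht => (neg_le_abs _).trans ht) (half_pos hε)
  have hWε := (tendsto_order.1 hW0.abs).2 (ε / 2) (by simpa using half_pos hε)
  filter_upwards [hp, hn, hWε] with t hp hn hWt
  have := abs_lt.1 hWt
  rw [abs_le]
  constructor <;> linarith

include h0 h1 hα hq hw hγ1 in
theorem tendsto_zero_of_contraction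
    (hg : ∀ t B, (∀ x, |q t x| ≤ B) → ∀ x, |g t x| ≤ γ * B)
    (hB : ∃ B, ∀ t x, |q t x| ≤ B) (x : X) : Tendsto (fun t => q t x) atTop (𝓝 0) := by
  obtain ⟨B, hB⟩ := hB
  set b := max B 1 with hb
  have hbpos : 0 < b := lt_max_of_lt_right one_pos
  -- A ratio strictly between `γ` and `1`: the slack `c - γ` supplies the `ε` of each round. The
  -- entry `1 / 2` keeps `c` positive.
  set c := max ((1 + γ) / 2) (1 / 2) with hc
  have hc0 : 0 < c := lt_max_of_lt_right (by norm_num)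
  have hc1 : c < 1 := max_lt (by linarith) (by norm_num)
  have hcγ : γ < c := lt_max_of_lt_left (by linarith)
  have key : ∀ n : ℕ, ∀ᶠ t in atTop, ∀ x, |q t x| ≤ c ^ n * b := fun n => by
    induction n with
    | zero =>
      refine Eventually.of_forall fun t x => ?_
      rw [pow_zero, one_mul]
      exact (hB t x).trans (le_max_left _ _)
    | succ n ih =>
      have hpos : 0 < c ^ n * b := by positivity
      have := eventually_le_of_contraction h0 h1 hα hq hw hg ih
        (ε := (c - γ) * (c ^ n * b)) (mul_pos (sub_pos.2 hcγ) hpos)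
      filter_upwards [this] with t ht x
      refine (ht x).trans (le_of_eq ?_)
      ring
  have hlim : Tendsto (fun n : ℕ => c ^ n * b) atTop (𝓝 0) := by
    simpa using (tendsto_pow_atTop_nhds_zero_of_lt_one hc0.le hc1).mul_const b
  rw [Metric.tendsto_nhds]
  intro ε hε
  obtain ⟨n, hn⟩ := (hlim.eventually (gt_mem_nhds hε)).exists
  filter_upwards [key n] with t ht
  simpa using (ht x).trans_lt hn

end Asynchronous

/-! ### Almost sure convergence of weighted noise -/

section Martingale

variable {Ω : Type*} {mΩ : MeasurableSpace Ω} {P : Measure Ω} [IsProbabilityMeasure P]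
  {ℱ : Filtration ℕ mΩ} {c d : ℕ → Ω → ℝ} (hc : ∀ t, Measurable[ℱ t] (c t))
  (hdm : ∀ t, Measurable[ℱ (t + 1)] (d t)) (hd2 : ∀ t, MemLp (d t) 2 P)
  (hd0 : ∀ t, P[d t | ℱ t] =ᵐ[P] 0) {C : ℝ}
  (hdC : ∀ t, P[fun ω => d t ω ^ 2 | ℱ t] ≤ᵐ[P] fun _ => C)

-- The partial sums form a martingale with orthogonal increments and second moments at most `C * K`.
-- It is therefore bounded in `L¹`, and Doob's convergence theorem applies.
include hc hdm hd2 hd0 hdC in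
theorem ae_exists_tendsto_sum_of_bounded {K : ℝ}
    (hK : ∀ T ω, ∑ t ∈ Finset.range T, c t ω ^ 2 ≤ K) :
    ∀ᵐ ω ∂P, ∃ L, Tendsto (fun T => ∑ t ∈ Finset.range T, c t ω * d t ω) atTop (𝓝 L) := by
  have hcm : ∀ t, Measurable (c t) := fun t => (hc t).mono (ℱ.le t) le_rfl
  have hcsq : ∀ t ω, c t ω ^ 2 ≤ K := fun t ω => by
    refine le_trans ?_ (hK (t + 1) ω)
    exact Finset.single_le_sum (f := fun t => c t ω ^ 2) (fun _ _ => sq_nonneg _)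
      (Finset.self_mem_range_succ t)
  have hcb : ∀ t ω, ‖c t ω‖ ≤ Real.sqrt K := fun t ω => Real.abs_le_sqrt (hcsq t ω)
  have hmem : ∀ {f : Ω → ℝ} t, MemLp f 2 P → MemLp (fun ω => c t ω * f ω) 2 P :=
    fun t hf => hf.mul (p := ⊤) (q := 2)
      (memLp_top_of_bound (hcm t).aestronglyMeasurable _ (ae_of_all _ (hcb t)))
  set M : ℕ → Ω → ℝ := fun T ω => ∑ t ∈ Finset.range T, c t ω * d t ω with hM
  have hMsucc : ∀ T ω, M (T + 1) ω = M T ω + c T ω * d T ω :=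
    fun T ω => Finset.sum_range_succ _ _
  have hML2 : ∀ T, MemLp (M T) 2 P := fun T => memLp_finsetSum _ fun t _ => hmem t (hd2 t)
  have hMmeas : ∀ T, Measurable[ℱ T] (M T) := fun T =>
    Finset.measurable_fun_sum _ fun t ht => by
      have ht := Finset.mem_range.1 ht
      exact ((hc t).mono (ℱ.mono ht.le) le_rfl).mul ((hdm t).mono (ℱ.mono ht) le_rfl)
  have hMadapt : StronglyAdapted ℱ M := fun T => (hMmeas T).stronglyMeasurable
  have hmart : Martingale M ℱ P := by
    refine martingale_of_condExp_sub_eq_zero_nat hMadapt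
      (fun T => (hML2 T).integrable (by norm_num)) fun T => ?_
    have he : M (T + 1) - M T = c T * d T := by
      funext ω
      simp [hMsucc]
    rw [he]
    have hpull := condExp_mul_of_stronglyMeasurable_left (μ := P) (m := ℱ T)
      (hc T).stronglyMeasurable ((hmem T (hd2 T)).integrable (by norm_num))
      ((hd2 T).integrable (by norm_num))
    filter_upwards [hpull, hd0 T] with ω h1 h2
    rw [h1]
    simp [h2]
  have hsq : ∀ T, ∫ ω, M T ω ^ 2 ∂P ≤ C * ∫ ω, ∑ t ∈ Finset.range T, c t ω ^ 2 ∂P := fun T => by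
    have hcint : ∀ t, Integrable (fun ω => c t ω ^ 2) P := fun t =>
      Integrable.of_bound ((hcm t).pow_const 2).aestronglyMeasurable K (ae_of_all _ fun ω => by
        rw [Real.norm_of_nonneg (sq_nonneg _)]
        exact hcsq t ω)
    induction T with
    | zero => simp [hM]
    | succ T ih =>
      -- The factor `c T * M T` is known at time `T` and `d T` has conditional mean zero.
      have hcross : ∫ ω, (c T ω * M T ω) * d T ω ∂P = 0 := by
        have hpull := condExp_mul_of_stronglyMeasurable_left (μ := P) (m := ℱ T)
          (f := fun ω => c T ω * M T ω) ((hc T).mul (hMmeas T)).stronglyMeasurable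
          ((hmem T (hML2 T)).integrable_mul (hd2 T)) ((hd2 T).integrable (by norm_num))
        rw [← integral_condExp (ℱ.le T)]
        refine integral_eq_zero_of_ae ?_
        filter_upwards [hpull, hd0 T] with ω h1 h2
        have : P[fun ω => c T ω * M T ω * d T ω | ℱ T] ω = (c T ω * M T ω) * P[d T | ℱ T] ω := h1
        rw [this, h2]
        simp
      have hquad : ∫ ω, c T ω ^ 2 * d T ω ^ 2 ∂P ≤ C * ∫ ω, c T ω ^ 2 ∂P := by
        have hint : Integrable (fun ω => c T ω ^ 2 * d T ω ^ 2) P := by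
          simpa [mul_pow] using (hmem T (hd2 T)).integrable_sq
        have hpull := condExp_mul_of_stronglyMeasurable_left (μ := P) (m := ℱ T)
          (f := fun ω => c T ω ^ 2) (g := fun ω => d T ω ^ 2)
          ((hc T).pow_const 2).stronglyMeasurable hint (hd2 T).integrable_sq
        rw [← integral_condExp (ℱ.le T), ← integral_const_mul]
        refine integral_mono_ae integrable_condExp ((hcint T).const_mul C) ?_
        filter_upwards [hpull, hdC T] with ω h1 h2
        have : P[fun ω => c T ω ^ 2 * d T ω ^ 2 | ℱ T] ω =
          c T ω ^ 2 * P[fun ω => d T ω ^ 2 | ℱ T] ω := h1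
        rw [this, mul_comm C]
        exact mul_le_mul_of_nonneg_left h2 (sq_nonneg _)
      have hexp : ∀ ω, M (T + 1) ω ^ 2 =
          M T ω ^ 2 + 2 * ((c T ω * M T ω) * d T ω) + c T ω ^ 2 * d T ω ^ 2 := fun ω => by
        rw [hMsucc]
        ring
      simp only [hexp, Finset.sum_range_succ]
      have i1 := (hML2 T).integrable_sq
      have i2 : Integrable (fun ω => 2 * ((c T ω * M T ω) * d T ω)) P :=
        ((hmem T (hML2 T)).integrable_mul (hd2 T)).const_mul 2
      have i3 : Integrable (fun ω => c T ω ^ 2 * d T ω ^ 2) P := by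
        simpa [mul_pow] using (hmem T (hd2 T)).integrable_sq
      have i12 : Integrable (fun ω => M T ω ^ 2 + 2 * ((c T ω * M T ω) * d T ω)) P := i1.add i2
      rw [integral_add i12 i3, integral_add i1 i2, integral_const_mul, hcross,
        integral_add (integrable_finsetSum _ fun t _ => hcint t) (hcint T)]
      linarith
  have hC0 : 0 ≤ C := by
    have h := hdC 0
    have h2 : 0 ≤ᵐ[P] P[fun ω => d 0 ω ^ 2 | ℱ 0] :=
      condExp_nonneg (ae_of_all _ fun ω => sq_nonneg _)
    obtain ⟨ω, h3, h4⟩ := (h.and h2).exists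
    exact h4.trans h3
  have hbdd : ∀ T, eLpNorm (M T) 1 P ≤ (Real.toNNReal (1 + C * K) : NNReal) := fun T => by
    have hi : Integrable (M T) P := (hML2 T).integrable (by norm_num)
    rw [eLpNorm_one_eq_lintegral_enorm, ← ofReal_integral_norm_eq_lintegral_enorm hi]
    refine ENNReal.ofReal_le_ofReal ?_
    have hle : ∫ ω, ‖M T ω‖ ∂P ≤ ∫ ω, (1 + M T ω ^ 2) ∂P := by
      refine integral_mono hi.norm ((integrable_const 1).add (hML2 T).integrable_sq) fun ω => ?_
      change |M T ω| ≤ 1 + M T ω ^ 2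
      rw [abs_le]
      constructor <;> nlinarith [sq_nonneg (M T ω - 1), sq_nonneg (M T ω + 1)]
    rw [integral_add (integrable_const 1) (hML2 T).integrable_sq] at hle
    have hKi : ∫ ω, ∑ t ∈ Finset.range T, c t ω ^ 2 ∂P ≤ K := by
      have h := norm_integral_le_of_norm_le_const (μ := P) (C := K)
        (f := fun ω => ∑ t ∈ Finset.range T, c t ω ^ 2) (ae_of_all _ fun ω => by
          rw [Real.norm_of_nonneg (Finset.sum_nonneg fun _ _ => sq_nonneg _)]
          exact hK T ω)
      simpa using (le_abs_self _).trans h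
    have := mul_le_mul_of_nonneg_left hKi hC0
    have hsqT := hsq T
    simp only [integral_const, probReal_univ, one_smul] at hle
    linarith
  filter_upwards [hmart.submartingale.ae_tendsto_limitProcess hbdd] with ω hω
  exact ⟨_, hω⟩

-- Localisation: coefficients are set to zero once their sum of squares exceeds `K`. A path with
-- finite total agrees with its truncation for some natural `K`.
include hc hdm hd2 hd0 hdC in
theorem ae_exists_tendsto_sum (hsum : ∀ᵐ ω ∂P, Summable fun t => c t ω ^ 2) :
    ∀ᵐ ω ∂P, ∃ L, Tendsto (fun T => ∑ t ∈ Finset.range T, c t ω * d t ω) atTop (𝓝 L) := by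
  classical
  let σ : ℕ → Ω → ℝ := fun t ω => ∑ k ∈ Finset.range t, c k ω ^ 2
  -- The sum includes the index `t` and is still known at time `t`, so the truncated coefficients
  -- stay predictable and never overshoot `K`.
  have hσ : ∀ t, Measurable[ℱ t] (σ (t + 1)) := fun t =>
    Finset.measurable_fun_sum _ fun k hk =>
      ((hc k).mono (ℱ.mono (Nat.lt_succ_iff.1 (Finset.mem_range.1 hk))) le_rfl).pow_const 2
  let c' : ℕ → ℕ → Ω → ℝ := fun K t ω => if σ (t + 1) ω ≤ K then c t ω else 0
  have hc' : ∀ K t, Measurable[ℱ t] (c' K t) := fun K t =>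
    Measurable.ite (hσ t measurableSet_Iic) (hc t)
      measurable_const
  have hK : ∀ (K T : ℕ) ω, ∑ t ∈ Finset.range T, c' K t ω ^ 2 ≤ K := fun K T ω => by
    suffices h : ∑ t ∈ Finset.range T, c' K t ω ^ 2 ≤ K ∧
      ∑ t ∈ Finset.range T, c' K t ω ^ 2 ≤ σ T ω from h.1
    induction T with
    | zero => simp [σ]
    | succ T ih =>
      have hs : σ (T + 1) ω = σ T ω + c T ω ^ 2 := Finset.sum_range_succ _ _
      rw [Finset.sum_range_succ]
      by_cases hle : σ (T + 1) ω ≤ K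
      · simp only [c', hle, if_true] at ih ⊢
        constructor <;> linarith [ih.2]
      · have h0 : c' K T ω = 0 := if_neg hle
        rw [h0]
        constructor <;> nlinarith [ih.1, ih.2, sq_nonneg (c T ω)]
  have hall := ae_all_iff.2 fun K =>
    ae_exists_tendsto_sum_of_bounded (hc' K) hdm hd2 hd0 hdC (hK K)
  filter_upwards [hall, hsum] with ω h1 h2
  obtain ⟨K, hKω⟩ := exists_nat_ge (∑' t, c t ω ^ 2)
  obtain ⟨L, hL⟩ := h1 K
  refine ⟨L, hL.congr fun T => Finset.sum_congr rfl fun t _ => ?_⟩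
  have : c' K t ω = c t ω :=
    if_pos ((h2.sum_le_tsum _ fun _ _ => sq_nonneg _).trans hKω)
  rw [this]

end Martingale

end StochasticApproximation

/-! ### Conditional expectations given a finitely valued state -/

section FiniteConditioning

variable {Ω E F : Type*} [Finite E] [MeasurableSpace E] [MeasurableSingletonClass E]
  [MeasurableSpace F] {m mΩ : MeasurableSpace Ω} {P : Measure Ω} [IsProbabilityMeasure P]
  (hm : m ≤ mΩ) {X : Ω → E} {Y : Ω → F} (hX : Measurable[m] X) (hY : Measurable Y)
  {κ : E → Measure F} (hκ : ∀ e, IsProbabilityMeasure (κ e))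
  (h : ∀ B, MeasurableSet B →
    P[(Y ⁻¹' B).indicator (fun _ => (1 : ℝ)) | m] =ᵐ[P] fun ω => (κ (X ω)).real B)

include hm hX hY hκ h

-- Integrating the conditional probability of `Y ⁻¹' B` over an event of `m` on which `X = e` gives
-- the constant `κ e B` times its probability.
omit [Finite E] in
theorem map_restrict_eq_smul_of_condLaw {t : Set Ω} (ht : MeasurableSet[m] t) (e : E) :
    (P.restrict (t ∩ X ⁻¹' {e})).map Y = P (t ∩ X ⁻¹' {e}) • κ e := by
  have hs : MeasurableSet[m] (t ∩ X ⁻¹' {e}) := ht.inter (hX (measurableSet_singleton e))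
  set s := t ∩ X ⁻¹' {e} with hsdef
  refine Measure.ext fun B hB => ?_
  have hYB := hY hB
  rw [Measure.map_apply hY hB, Measure.restrict_apply hYB, Measure.smul_apply, smul_eq_mul]
  have hi : Integrable ((Y ⁻¹' B).indicator fun _ => (1 : ℝ)) P :=
    (integrable_const 1).indicator hYB
  have h1 := setIntegral_condExp hm hi hs
  rw [setIntegral_congr_ae (g := fun _ => (κ e).real B) (hm _ hs)
    ((h B hB).mono fun ω hω hωs => hω.trans (by rw [← show X ω = e from hωs.2])),
    setIntegral_const, setIntegral_indicator hYB, setIntegral_const] at h1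
  simp only [smul_eq_mul, mul_one, measureReal_def] at h1
  rw [← ENNReal.toReal_mul, ENNReal.toReal_eq_toReal_iff'
    (ENNReal.mul_ne_top (measure_ne_top _ _) (measure_ne_top _ _)) (measure_ne_top _ _)] at h1
  rw [h1, Set.inter_comm]

theorem integrable_comp_of_condLaw {f : F → ℝ} (hf : ∀ e, Integrable f (κ e)) :
    Integrable (fun ω => f (Y ω)) P := by
  have hu : (⋃ e, X ⁻¹' {e}) = Set.univ := by
    ext ω
    simp
  rw [← integrableOn_univ, ← hu, integrableOn_finite_iUnion]
  intro e
  have h1 := map_restrict_eq_smul_of_condLaw hm hX hY hκ h .univ e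
  rw [Set.univ_inter] at h1
  have h2 : Integrable f ((P.restrict (X ⁻¹' {e})).map Y) := by
    rw [h1]
    exact (hf e).smul_measure (measure_ne_top _ _)
  exact h2.comp_measurable hY

/-- Passes from indicators to unbounded integrable `f`: cut an event of `m` along the finitely many
values of `X` and use the law of `Y` on each piece. -/
theorem condExp_comp_of_condLaw {f : F → ℝ} (hf : ∀ e, Integrable f (κ e)) :
    P[fun ω => f (Y ω) | m] =ᵐ[P] fun ω => ∫ y, f y ∂(κ (X ω)) := by
  cases nonempty_fintype E
  have hint := integrable_comp_of_condLaw hm hX hY hκ h hf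
  have hgm : Measurable[m] fun ω => ∫ y, f y ∂(κ (X ω)) :=
    (Measurable.of_discrete (f := fun e => ∫ y, f y ∂(κ e))).comp hX
  have hgi : Integrable (fun ω => ∫ y, f y ∂(κ (X ω))) P := by
    obtain ⟨C, hC⟩ := Finite.exists_le fun e => ‖∫ y, f y ∂(κ e)‖
    exact Integrable.of_bound (hgm.mono hm le_rfl).aestronglyMeasurable C
      (ae_of_all _ fun ω => hC _)
  refine (ae_eq_condExp_of_forall_setIntegral_eq hm hint (fun s _ _ => hgi.integrableOn)
    (fun s hs _ => ?_) hgm.aestronglyMeasurable).symm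
  have hu : (⋃ e, s ∩ X ⁻¹' {e}) = s := by
    ext ω
    simp
  have hme : ∀ e, MeasurableSet (s ∩ X ⁻¹' {e}) := fun e =>
    hm _ (hs.inter (hX (measurableSet_singleton e)))
  have hd : Pairwise (Function.onFun Disjoint fun e => s ∩ X ⁻¹' {e}) := fun e e' hne =>
    Set.disjoint_left.2 fun ω h1 h2 => hne (h1.2.symm.trans h2.2)
  rw [← hu, integral_iUnion_fintype hme hd fun e => hgi.integrableOn,
    integral_iUnion_fintype hme hd fun e => hint.integrableOn]
  refine Finset.sum_congr rfl fun e _ => ?_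
  have h1 := map_restrict_eq_smul_of_condLaw hm hX hY hκ h hs e
  have hfm : AEStronglyMeasurable f ((P.restrict (s ∩ X ⁻¹' {e})).map Y) := by
    rw [h1]
    exact ((hf e).smul_measure (measure_ne_top _ _)).aestronglyMeasurable
  rw [← integral_map hY.aemeasurable hfm, h1, integral_smul_measure,
    setIntegral_congr_fun (g := fun _ => ∫ y, f y ∂(κ e)) (hme e)
      (fun ω hω => by rw [show X ω = e from hω.2]), setIntegral_const]
  rfl

end FiniteConditioning

/-! ### Innovations of a single area along a run -/

namespace SharingSystem

namespace Run

variable {ι : Type*} {N : SharingSystem ι} [Fintype ι]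

section

variable {Ω : Type*} [mΩ : MeasurableSpace Ω] {P : Measure Ω} (D : N.Run P)

/-- The state of area `i` at the instant `t`. -/
def areaState (i : ι) (t : ℕ) (ω : Ω) : N.AreaState i := N.proj (D.state t ω) i

theorem measurable_areaState (i : ι) (t : ℕ) : Measurable[D.ℱ t] (D.areaState i t) :=
  (Measurable.of_discrete (f := fun s : N.State => N.proj s i)).comp (D.state_meas t)

theorem measurable_areaAction (i : ι) (t : ℕ) : Measurable[D.ℱ t] fun ω => D.action t ω i :=
  (measurable_pi_apply i).comp (D.action_meas t)

theorem measurable_areaFail (i : ι) (t : ℕ) : Measurable[D.ℱ (t + 1)] fun ω => D.fail t ω i :=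
  (measurable_pi_apply i).comp (D.fail_meas t)

/-- The deviation of `g`, a function of the next state and the failures of area `i`, from its
conditional expectation. -/
def innovation (i : ι) (g : N.AreaState i × ℕ → ℝ) (t : ℕ) (ω : Ω) : ℝ :=
  g (D.areaState i (t + 1) ω, D.fail t ω i) -
    ∫ y, g y ∂(N.areaLaw i (D.areaState i t ω) (D.action t ω i))

variable (i : ι) (g : N.AreaState i × ℕ → ℝ)

theorem measurable_areaOutcome (t : ℕ) :
    Measurable[D.ℱ (t + 1)] fun ω => g (D.areaState i (t + 1) ω, D.fail t ω i) :=
  (Measurable.of_discrete (f := g)).comp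
    ((D.measurable_areaState i (t + 1)).prodMk (D.measurable_areaFail i t))

theorem measurable_areaMean (t : ℕ) : Measurable[D.ℱ t] fun ω =>
    ∫ y, g y ∂(N.areaLaw i (D.areaState i t ω) (D.action t ω i)) :=
  (Measurable.of_discrete (f := fun x : N.AreaState i × N.AreaAction i =>
    ∫ y, g y ∂(N.areaLaw i x.1 x.2))).comp
    ((D.measurable_areaState i t).prodMk (D.measurable_areaAction i t))

theorem measurable_innovation (t : ℕ) : Measurable[D.ℱ (t + 1)] (D.innovation i g t) :=
  (D.measurable_areaOutcome i g t).sub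
    ((D.measurable_areaMean i g t).mono (D.ℱ.mono t.le_succ) le_rfl)

variable [IsProbabilityMeasure P] {g}

theorem integrable_areaOutcome (hg : ∀ s a, Integrable g (N.areaLaw i s a)) (t : ℕ) :
    Integrable (fun ω => g (D.areaState i (t + 1) ω, D.fail t ω i)) P :=
  integrable_comp_of_condLaw (D.ℱ.le t)
    (X := fun ω => (D.state t ω, D.action t ω))
    (Y := fun ω => (D.state (t + 1) ω, D.fail t ω))
    (κ := fun x => N.jointLaw x.1 x.2)
    ((D.state_meas t).prodMk (D.action_meas t))
    (((D.state_meas (t + 1)).prodMk (D.fail_meas t)).mono (D.ℱ.le (t + 1)) le_rfl)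
    (fun _ => inferInstance) (D.dynamics t)
    (f := fun y => g (N.proj y.1 i, y.2 i))
    fun x => N.integrable_jointLaw_area x.1 x.2 i (hg _ _)

theorem condExp_areaOutcome (hg : ∀ s a, Integrable g (N.areaLaw i s a)) (t : ℕ) :
    P[fun ω => g (D.areaState i (t + 1) ω, D.fail t ω i) | D.ℱ t] =ᵐ[P] fun ω =>
      ∫ y, g y ∂(N.areaLaw i (D.areaState i t ω) (D.action t ω i)) := by
  have h := condExp_comp_of_condLaw (D.ℱ.le t)
    (X := fun ω => (D.state t ω, D.action t ω))
    (Y := fun ω => (D.state (t + 1) ω, D.fail t ω))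
    (κ := fun x => N.jointLaw x.1 x.2)
    ((D.state_meas t).prodMk (D.action_meas t))
    (((D.state_meas (t + 1)).prodMk (D.fail_meas t)).mono (D.ℱ.le (t + 1)) le_rfl)
    (fun _ => inferInstance) (D.dynamics t)
    (f := fun y => g (N.proj y.1 i, y.2 i))
    fun x => N.integrable_jointLaw_area x.1 x.2 i (hg _ _)
  simp only [integral_jointLaw_area] at h
  exact h

omit [Fintype ι] in
theorem exists_areaMean_le (g : N.AreaState i × ℕ → ℝ) :
    ∃ C, ∀ s a, |∫ y, g y ∂(N.areaLaw i s a)| ≤ C := by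
  obtain ⟨C, hC⟩ := Finite.exists_le fun x : N.AreaState i × N.AreaAction i =>
    |∫ y, g y ∂(N.areaLaw i x.1 x.2)|
  exact ⟨C, fun s a => hC (s, a)⟩

theorem integrable_areaMean (g : N.AreaState i × ℕ → ℝ) (t : ℕ) : Integrable (fun ω =>
    ∫ y, g y ∂(N.areaLaw i (D.areaState i t ω) (D.action t ω i))) P := by
  obtain ⟨C, hC⟩ := exists_areaMean_le i g
  exact Integrable.of_bound
    ((D.measurable_areaMean i g t).mono (D.ℱ.le t) le_rfl).aestronglyMeasurable C
    (ae_of_all _ fun ω => hC _ _)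

theorem condExp_innovation (hg : ∀ s a, Integrable g (N.areaLaw i s a)) (t : ℕ) :
    P[D.innovation i g t | D.ℱ t] =ᵐ[P] 0 := by
  have h1 := condExp_sub (D.integrable_areaOutcome i hg t) (D.integrable_areaMean i g t) (D.ℱ t)
  rw [condExp_of_stronglyMeasurable (D.ℱ.le t) (D.measurable_areaMean i g t).stronglyMeasurable
    (D.integrable_areaMean i g t)] at h1
  filter_upwards [h1, D.condExp_areaOutcome i hg t] with ω h1 h2
  refine h1.trans ?_
  rw [Pi.sub_apply, h2, sub_self]
  rfl

omit [Fintype ι] in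
theorem integrable_of_sq (hg2 : ∀ s a, Integrable (fun y => g y ^ 2) (N.areaLaw i s a))
    (s : N.AreaState i) (a : N.AreaAction i) : Integrable g (N.areaLaw i s a) :=
  ((memLp_two_iff_integrable_sq (μ := N.areaLaw i s a) (f := g)
    Measurable.of_discrete.aestronglyMeasurable).2 (hg2 s a)).integrable (by norm_num)

theorem memLp_innovation (hg2 : ∀ s a, Integrable (fun y => g y ^ 2) (N.areaLaw i s a)) (t : ℕ) :
    MemLp (D.innovation i g t) 2 P := by
  have h1 : MemLp (fun ω => g (D.areaState i (t + 1) ω, D.fail t ω i)) 2 P :=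
    (memLp_two_iff_integrable_sq ((D.measurable_areaOutcome i g t).mono
      (D.ℱ.le (t + 1)) le_rfl).aestronglyMeasurable).2
        (D.integrable_areaOutcome i (g := fun y => g y ^ 2) hg2 t)
  obtain ⟨C, hC⟩ := exists_areaMean_le i g
  exact h1.sub (MemLp.of_bound
    ((D.measurable_areaMean i g t).mono (D.ℱ.le t) le_rfl).aestronglyMeasurable C
    (ae_of_all _ fun ω => hC _ _))

/-- From `(a - b) ^ 2 ≤ 2 * a ^ 2 + 2 * b ^ 2`; the bound is uniform in time because an area has
finitely many state-action pairs. -/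
theorem exists_condExp_innovation_sq_le
    (hg2 : ∀ s a, Integrable (fun y => g y ^ 2) (N.areaLaw i s a)) :
    ∃ C, ∀ t, P[fun ω => D.innovation i g t ω ^ 2 | D.ℱ t] ≤ᵐ[P] fun _ => C := by
  obtain ⟨C₁, hC₁⟩ := exists_areaMean_le i g
  obtain ⟨C₂, hC₂⟩ := exists_areaMean_le i fun y => g y ^ 2
  refine ⟨2 * C₂ + 2 * C₁ ^ 2, fun t => ?_⟩
  have hi := D.integrable_areaOutcome i (g := fun y => g y ^ 2) hg2 t
  have hle : ∀ ω, D.innovation i g t ω ^ 2 ≤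
      2 * g (D.areaState i (t + 1) ω, D.fail t ω i) ^ 2 + 2 * C₁ ^ 2 := fun ω => by
    have h1 := sq_le_sq' (abs_le.1 (hC₁ (D.areaState i t ω) (D.action t ω i))).1
      (abs_le.1 (hC₁ (D.areaState i t ω) (D.action t ω i))).2
    unfold innovation
    nlinarith [sq_nonneg (g (D.areaState i (t + 1) ω, D.fail t ω i) +
      ∫ y, g y ∂(N.areaLaw i (D.areaState i t ω) (D.action t ω i)))]
  have hmono := condExp_mono (m := D.ℱ t) (D.memLp_innovation i hg2 t).integrable_sq
    ((hi.const_mul 2).add (integrable_const (2 * C₁ ^ 2))) (ae_of_all _ hle)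
  have hadd := condExp_add (hi.const_mul 2) (integrable_const (2 * C₁ ^ 2)) (D.ℱ t)
  have hsmul := condExp_smul (μ := P) (2 : ℝ)
    (fun ω => g (D.areaState i (t + 1) ω, D.fail t ω i) ^ 2) (D.ℱ t)
  rw [condExp_const (D.ℱ.le t)] at hadd
  filter_upwards [hmono, hadd, hsmul, D.condExp_areaOutcome i (g := fun y => g y ^ 2) hg2 t]
    with ω h1 h2 h3 h4
  refine h1.trans (h2.le.trans ?_)
  have h3' : P[fun ω => 2 * g (D.areaState i (t + 1) ω, D.fail t ω i) ^ 2 | D.ℱ t] ω =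
    2 * P[fun ω => g (D.areaState i (t + 1) ω, D.fail t ω i) ^ 2 | D.ℱ t] ω := h3
  rw [Pi.add_apply, h3', h4]
  have := (le_abs_self _).trans (hC₂ (D.areaState i t ω) (D.action t ω i))
  linarith

theorem ae_exists_tendsto_sum_innovation
    (hg2 : ∀ s a, Integrable (fun y => g y ^ 2) (N.areaLaw i s a)) {c : ℕ → Ω → ℝ}
    (hc : ∀ t, Measurable[D.ℱ t] (c t)) (hsum : ∀ᵐ ω ∂P, Summable fun t => c t ω ^ 2) :
    ∀ᵐ ω ∂P, ∃ L, Tendsto (fun T => ∑ t ∈ Finset.range T, c t ω * D.innovation i g t ω)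
      atTop (𝓝 L) := by
  obtain ⟨C, hC⟩ := D.exists_condExp_innovation_sq_le i hg2
  exact StochasticApproximation.ae_exists_tendsto_sum hc (D.measurable_innovation i g)
    (D.memLp_innovation i hg2) (D.condExp_innovation i (integrable_of_sq i hg2)) hC hsum

end

end Run

end SharingSystem

/-! ### Greedy policies and finite maxima -/

theorem eventually_forall_isGreedy_eq {S A : Type*} [Finite S] [Finite A] {q : ℕ → S → A → ℝ}
    {q' : S → A → ℝ} (h : ∀ s a, Tendsto (fun t => q t s a) atTop (𝓝 (q' s a))) :
    ∀ᶠ t in atTop, ∀ d : S → A, IsGreedy (q t) d → IsGreedy q' d := by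
  -- The finitely many strict inequalities of the limit table eventually hold in `q t`, so no action
  -- that is suboptimal in the limit stays greedy.
  have hlt : ∀ᶠ t in atTop, ∀ s a b, q' s a < q' s b → q t s a < q t s b := by
    simp only [eventually_all]
    exact fun s a b hab => (h s a).eventually_lt (h s b) hab
  filter_upwards [hlt] with t ht d hd s a
  by_contra hc
  exact absurd (hd s a) (not_le.2 (ht s _ _ (not_le.1 hc)))

theorem MDP.IntegrableReward.isGreedy_optQ_iff {S A : Type*} [MeasurableSpace S] [Finite S]
    [MeasurableSingletonClass S] [Fintype A] [Nonempty A] {M : MDP S A} (hM : M.IntegrableReward)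
    (d : S → A) : IsGreedy M.optQ d ↔ M.Solves d := by
  rw [hM.solves_iff]
  refine forall_congr' fun s => ⟨fun h => le_antisymm (hM.optQ_le s _) ?_, fun h a => ?_⟩
  · rw [hM.optValue_eq_iSup]
    exact ciSup_le h
  · rw [h]
    exact hM.optQ_le s a

theorem abs_ciSup_le_of_forall {A : Type*} [Finite A] [Nonempty A] {f : A → ℝ} {B : ℝ}
    (h : ∀ a, |f a| ≤ B) : |⨆ a, f a| ≤ B := by
  obtain ⟨a, ha⟩ := exists_eq_ciSup_of_finite (f := f)
  rw [← ha]
  exact h a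

theorem abs_ciSup_sub_ciSup_le {A : Type*} [Finite A] [Nonempty A] {f g : A → ℝ} {B : ℝ}
    (h : ∀ a, |f a - g a| ≤ B) : |(⨆ a, f a) - ⨆ a, g a| ≤ B := by
  obtain ⟨a, ha⟩ := exists_eq_ciSup_of_finite (f := f)
  obtain ⟨b, hb⟩ := exists_eq_ciSup_of_finite (f := g)
  have h1 := le_ciSup (Set.finite_range g).bddAbove a
  have h2 := le_ciSup (Set.finite_range f).bddAbove b
  have h3 := abs_le.1 (h a)
  have h4 := abs_le.1 (h b)
  rw [abs_le]
  constructor <;> linarith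

/-! ### Convergence of single-agent Q-learning -/

namespace SharingSystem

variable {ι : Type*} (N : SharingSystem ι)

/-- The expected reward of area `i`. -/
def meanReward (i : ι) (s : N.AreaState i) (a : N.AreaAction i) : ℝ :=
  ∫ y, N.areaReward i s a y.2 ∂(N.areaLaw i s a)

/-- The transition probabilities of area `i`. -/
def transProb (i : ι) (s : N.AreaState i) (a : N.AreaAction i) (z : N.AreaState i) : ℝ :=
  ∫ y, (if y.1 = z then 1 else 0) ∂(N.areaLaw i s a)

theorem integral_areaLaw_state (i : ι) (s : N.AreaState i) (a : N.AreaAction i)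
    (v : N.AreaState i → ℝ) :
    ∫ y, v y.1 ∂(N.areaLaw i s a) = ∑ z, N.transProb i s a z * v z := by
  have h : ∀ y : N.AreaState i × ℕ, v y.1 = ∑ z, (if y.1 = z then 1 else 0) * v z := fun y => by
    simp
  simp only [h, transProb]
  rw [integral_finsetSum]
  · simp only [integral_mul_const]
  · exact fun z _ => (N.integrable_areaLaw_state i s a fun x => if x = z then 1 else 0).mul_const _

theorem transProb_nonneg (i : ι) (s : N.AreaState i) (a : N.AreaAction i) (z : N.AreaState i) :
    0 ≤ N.transProb i s a z :=
  integral_nonneg fun y => by positivity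

theorem sum_transProb (i : ι) (s : N.AreaState i) (a : N.AreaAction i) :
    ∑ z, N.transProb i s a z = 1 := by
  simpa using (N.integral_areaLaw_state i s a fun _ => 1).symm

theorem areaMDP_optQ (i : ι) (s : N.AreaState i) (a : N.AreaAction i) :
    (N.areaMDP i).optQ s a = N.meanReward i s a +
      N.γ * ∑ z, N.transProb i s a z * ⨆ b, (N.areaMDP i).optQ z b := by
  rw [MDP.optQ_eq_lookahead, areaMDP_lookahead, integral_add (N.integrable_areaLaw_reward i s a)
    ((N.integrable_areaLaw_state i s a _).const_mul _), integral_const_mul,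
    N.integral_areaLaw_state i s a]
  simp only [(N.areaMDP_integrableReward i).optValue_eq_iSup]
  rfl

theorem areaReward_sub_meanReward (i : ι) (s : N.AreaState i) (a : N.AreaAction i) (f : ℕ) :
    N.areaReward i s a f - N.meanReward i s a =
      -(f - ∫ y, (y.2 : ℝ) ∂(N.areaLaw i s a)) := by
  have h : N.meanReward i s a = N.areaReward i s a 0 - ∫ y, (y.2 : ℝ) ∂(N.areaLaw i s a) := by
    have h1 : ∀ y : N.AreaState i × ℕ,
        N.areaReward i s a y.2 = N.areaReward i s a 0 - (y.2 : ℝ) := fun y => by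
      simp only [areaReward, Nat.cast_zero]
      ring
    simp only [meanReward, h1]
    rw [integral_sub (integrable_const _) (N.integrable_areaLaw_failures i s a)]
    simp
  rw [h]
  simp only [areaReward, Nat.cast_zero]
  ring

namespace Run

variable {N} [Fintype ι] {Ω : Type*} [mΩ : MeasurableSpace Ω] {P : Measure Ω} (D : N.Run P)
  (i : ι) (q₀ : N.AreaState i → N.AreaAction i → ℝ)

open Classical in
/-- The learning rate of agent `i` for the table entry `x`: zero unless `x` is visited. -/
def stepSize (x : N.AreaState i × N.AreaAction i) (t : ℕ) (ω : Ω) : ℝ :=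
  if N.proj (D.state t ω) i = x.1 ∧ D.action t ω i = x.2 then D.rate i t ω else 0

theorem stepSize_nonneg (x : N.AreaState i × N.AreaAction i) (t : ℕ) (ω : Ω) :
    0 ≤ D.stepSize i x t ω := by
  unfold stepSize
  split_ifs
  exacts [D.rate_nonneg i t ω, le_rfl]

theorem stepSize_le_rate (x : N.AreaState i × N.AreaAction i) (t : ℕ) (ω : Ω) :
    D.stepSize i x t ω ≤ D.rate i t ω := by
  unfold stepSize
  split_ifs
  exacts [le_rfl, D.rate_nonneg i t ω]

theorem measurable_stepSize (x : N.AreaState i × N.AreaAction i) (t : ℕ) :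
    Measurable[D.ℱ t] (D.stepSize i x t) := by
  classical
  refine Measurable.ite ?_ (D.rate_meas i t) measurable_const
  exact (D.measurable_areaState i t (measurableSet_singleton x.1)).inter
    (D.measurable_areaAction i t (measurableSet_singleton x.2))

/-- The state value in the table of agent `i`. -/
def tableValue (t : ℕ) (ω : Ω) (z : N.AreaState i) : ℝ := ⨆ b, D.Q i q₀ t ω z b

/-- With step size zero at entries that are not visited, one convex-combination rule covers all
entries, as asynchronous approximation requires. -/
theorem Q_succ (t : ℕ) (ω : Ω) (x : N.AreaState i × N.AreaAction i) :
    D.Q i q₀ (t + 1) ω x.1 x.2 = (1 - D.stepSize i x t ω) * D.Q i q₀ t ω x.1 x.2 +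
      D.stepSize i x t ω * (N.areaReward i x.1 x.2 (D.fail t ω i) +
        N.γ * D.tableValue i q₀ t ω (D.areaState i (t + 1) ω)) := by
  simp only [Q, qUpdate, stepSize]
  by_cases h : N.proj (D.state t ω) i = x.1 ∧ D.action t ω i = x.2
  · rw [if_pos ⟨h.1.symm, h.2.symm⟩, if_pos h, h.1, h.2]
    simp only [tableValue, areaState]
    ring
  · rw [if_neg fun h' => h ⟨h'.1.symm, h'.2.symm⟩, if_neg h]
    ring

/-- Separates table values known at time `t` from the random next state, so that the noise becomes
finitely many fixed innovations with predictable coefficients. -/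
theorem tableValue_next (t : ℕ) (ω : Ω) : D.tableValue i q₀ t ω (D.areaState i (t + 1) ω) =
    ∑ z, D.tableValue i q₀ t ω z * if D.areaState i (t + 1) ω = z then 1 else 0 := by
  simp

theorem measurable_tableValue_of {t : ℕ} (h : ∀ s a, Measurable[D.ℱ t] fun ω => D.Q i q₀ t ω s a)
    (z : N.AreaState i) : Measurable[D.ℱ t] fun ω => D.tableValue i q₀ t ω z :=
  Measurable.iSup fun b => h z b

theorem measurable_Q (t : ℕ) (s : N.AreaState i) (a : N.AreaAction i) :
    Measurable[D.ℱ t] fun ω => D.Q i q₀ t ω s a := by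
  induction t generalizing s a with
  | zero => exact measurable_const
  | succ t ih =>
    have hle := D.ℱ.mono t.le_succ
    have hs := (D.measurable_stepSize i (s, a) t).mono hle le_rfl
    have hV : Measurable[D.ℱ (t + 1)]
        fun ω => D.tableValue i q₀ t ω (D.areaState i (t + 1) ω) := by
      simp only [tableValue_next]
      refine Finset.measurable_fun_sum _ fun z _ => ?_
      exact ((D.measurable_tableValue_of i q₀ ih z).mono hle le_rfl).mul
        ((Measurable.of_discrete (f := fun y => if y = z then (1 : ℝ) else 0)).comp
          (D.measurable_areaState i (t + 1)))
    have hR := (Measurable.of_discrete (f := N.areaReward i s a)).comp (D.measurable_areaFail i t)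
    have he := fun ω => D.Q_succ i q₀ t ω (s, a)
    simp only at he
    simp only [he]
    exact ((measurable_const.sub hs).mul ((ih s a).mono hle le_rfl)).add
      (hs.mul (hR.add (hV.const_mul _)))

theorem measurable_tableValue (t : ℕ) (z : N.AreaState i) :
    Measurable[D.ℱ t] fun ω => D.tableValue i q₀ t ω z :=
  D.measurable_tableValue_of i q₀ (D.measurable_Q i q₀ t) z

/-- The deviation of the failures from their conditional expectation. -/
abbrev failNoise : ℕ → Ω → ℝ := D.innovation i fun y => (y.2 : ℝ)

/-- The deviation of a visit to `z` at the next instant from its conditional probability. -/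
abbrev visitNoise (z : N.AreaState i) : ℕ → Ω → ℝ :=
  D.innovation i fun y => if y.1 = z then 1 else 0

/-- The step size vanishes unless `x` is the current pair, so the mean at the current pair may be
replaced by the mean at `x`. -/
theorem stepSize_mul_reward (x : N.AreaState i × N.AreaAction i) (t : ℕ) (ω : Ω) :
    D.stepSize i x t ω * N.areaReward i x.1 x.2 (D.fail t ω i) =
      D.stepSize i x t ω * (N.meanReward i x.1 x.2 + -D.failNoise i t ω) := by
  by_cases h : N.proj (D.state t ω) i = x.1 ∧ D.action t ω i = x.2
  · have := N.areaReward_sub_meanReward i x.1 x.2 (D.fail t ω i)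
    simp only [failNoise, innovation, areaState, h.1, h.2]
    rw [← this]
    ring
  · simp [stepSize, h]

theorem stepSize_mul_tableValue (x : N.AreaState i × N.AreaAction i) (t : ℕ) (ω : Ω) :
    D.stepSize i x t ω * D.tableValue i q₀ t ω (D.areaState i (t + 1) ω) =
      D.stepSize i x t ω * (∑ z, N.transProb i x.1 x.2 z * D.tableValue i q₀ t ω z +
        ∑ z, D.tableValue i q₀ t ω z * D.visitNoise i z t ω) := by
  by_cases h : N.proj (D.state t ω) i = x.1 ∧ D.action t ω i = x.2
  · rw [tableValue_next, ← Finset.sum_add_distrib]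
    congr 1
    refine Finset.sum_congr rfl fun z _ => ?_
    simp only [visitNoise, innovation, areaState, h.1, h.2, transProb]
    ring
  · simp [stepSize, h]

-- The sampled value of the next state stays in the drift, so the only noise is that of the
-- failures, whose coefficients do not involve the table.
variable {D i} in
theorem exists_abs_Q_le {ω : Ω} (hω : (Summable fun t => D.rate i t ω ^ 2) ∧
    ∀ (x : N.AreaState i × N.AreaAction i),
      Tendsto (fun T => ∑ t ∈ Finset.range T, D.stepSize i x t ω) atTop atTop)
    (hf : ∀ x : N.AreaState i × N.AreaAction i, ∃ L, Tendsto (fun T => ∑ t ∈ Finset.range T,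
      D.stepSize i x t ω * D.failNoise i t ω) atTop (𝓝 L)) :
    ∃ B, ∀ t (x : N.AreaState i × N.AreaAction i), |D.Q i q₀ t ω x.1 x.2| ≤ B := by
  obtain ⟨r, hr⟩ := Finite.exists_le fun x : N.AreaState i × N.AreaAction i =>
    |N.meanReward i x.1 x.2|
  refine StochasticApproximation.bounded_of_average
    (q := fun t x => D.Q i q₀ t ω x.1 x.2)
    (g := fun t x => N.meanReward i x.1 x.2 +
      N.γ * D.tableValue i q₀ t ω (D.areaState i (t + 1) ω))
    (w := fun t _ => -D.failNoise i t ω) (α := fun x t => D.stepSize i x t ω) (r := r)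
    (fun x t => D.stepSize_nonneg i x t ω)
    (fun x t => (D.stepSize_le_rate i x t ω).trans (D.rate_le_one i t ω)) hω.2
    (fun t x => ?_) (fun x => ?_) N.γ_lt_one fun t B hB x => ?_
  · have := D.stepSize_mul_reward i x t ω
    rw [D.Q_succ i q₀ t ω x]
    linarith
  · obtain ⟨L, hL⟩ := hf x
    refine ⟨-L, ?_⟩
    simpa only [mul_neg, Finset.sum_neg_distrib] using hL.neg
  · refine (abs_add_le _ _).trans (add_le_add (hr x) ?_)
    rw [abs_mul, abs_of_nonneg N.γ_nonneg]
    exact mul_le_mul_of_nonneg_left (abs_ciSup_le_of_forall fun b => hB (_, b)) N.γ_nonneg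

/-- The bound on `v` may depend on the path, which is all that boundedness of the tables provides.
-/
theorem ae_summable_stepSize_mul_sq (hD : D.RobbinsMonro) (x : N.AreaState i × N.AreaAction i)
    {v : ℕ → Ω → ℝ} (hv : ∀ᵐ ω ∂P, ∃ B, ∀ t, |v t ω| ≤ B) :
    ∀ᵐ ω ∂P, Summable fun t => (D.stepSize i x t ω * v t ω) ^ 2 := by
  filter_upwards [hD i, hv] with ω h ⟨B, hB⟩
  refine Summable.of_nonneg_of_le (fun t => sq_nonneg _) (fun t => ?_) (h.1.mul_right (B ^ 2))
  rw [mul_pow]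
  refine mul_le_mul ?_ ?_ (sq_nonneg _) (sq_nonneg _)
  · exact pow_le_pow_left₀ (D.stepSize_nonneg i x t ω) (D.stepSize_le_rate i x t ω) 2
  · exact sq_le_sq' (abs_le.1 (hB t)).1 (abs_le.1 (hB t)).2

variable [IsProbabilityMeasure P]

theorem ae_tendsto_sum_failNoise (hD : D.RobbinsMonro) :
    ∀ᵐ ω ∂P, ∀ x : N.AreaState i × N.AreaAction i, ∃ L, Tendsto (fun T =>
      ∑ t ∈ Finset.range T, D.stepSize i x t ω * D.failNoise i t ω) atTop (𝓝 L) := by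
  refine ae_all_iff.2 fun x => D.ae_exists_tendsto_sum_innovation i
    (fun s a => N.integrable_areaLaw_sq i s a) (D.measurable_stepSize i x) ?_
  simpa using D.ae_summable_stepSize_mul_sq i hD x (v := fun _ _ => 1)
    (ae_of_all _ fun ω => ⟨1, fun t => by simp⟩)

theorem ae_exists_abs_Q_le (hD : D.RobbinsMonro) : ∀ᵐ ω ∂P, ∃ B,
    ∀ t (x : N.AreaState i × N.AreaAction i), |D.Q i q₀ t ω x.1 x.2| ≤ B := by
  filter_upwards [hD i, D.ae_tendsto_sum_failNoise i hD] with ω h hf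
  exact exists_abs_Q_le q₀ ⟨h.1, fun x => h.2 x.1 x.2⟩ hf

theorem ae_tendsto_sum_visitNoise (hD : D.RobbinsMonro) :
    ∀ᵐ ω ∂P, ∀ (x : N.AreaState i × N.AreaAction i) (z : N.AreaState i), ∃ L, Tendsto (fun T =>
      ∑ t ∈ Finset.range T, D.stepSize i x t ω * D.tableValue i q₀ t ω z * D.visitNoise i z t ω)
        atTop (𝓝 L) := by
  refine ae_all_iff.2 fun x => ae_all_iff.2 fun z => D.ae_exists_tendsto_sum_innovation i
    (c := fun t ω => D.stepSize i x t ω * D.tableValue i q₀ t ω z)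
    (fun s a => N.integrable_areaLaw_state i s a fun y => (if y = z then (1 : ℝ) else 0) ^ 2)
    (fun t => (D.measurable_stepSize i x t).mul (D.measurable_tableValue i q₀ t z)) ?_
  refine D.ae_summable_stepSize_mul_sq i hD x ?_
  filter_upwards [D.ae_exists_abs_Q_le i q₀ hD] with ω ⟨B, hB⟩
  exact ⟨B, fun t => abs_ciSup_le_of_forall fun b => hB t (z, b)⟩

/-- Single-agent Q-learning converges almost surely to the optimal action values. -/
theorem ae_tendsto_Q (hD : D.RobbinsMonro) : ∀ᵐ ω ∂P, ∀ s a,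
    Tendsto (fun t => D.Q i q₀ t ω s a) atTop (𝓝 ((N.areaMDP i).optQ s a)) := by
  filter_upwards [hD i, D.ae_tendsto_sum_failNoise i hD, D.ae_exists_abs_Q_le i q₀ hD,
    D.ae_tendsto_sum_visitNoise i q₀ hD] with ω hω hf ⟨B, hB⟩ hv s a
  set V : N.AreaState i → ℝ := fun z => ⨆ b, (N.areaMDP i).optQ z b with hV
  obtain ⟨B', hB'⟩ := Finite.exists_le fun x : N.AreaState i × N.AreaAction i =>
    |(N.areaMDP i).optQ x.1 x.2|
  -- Now the drift is the conditional mean of the table error at the next state, and the deviation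
  -- of the next state joins the noise.
  have key := StochasticApproximation.tendsto_zero_of_contraction
    (q := fun t (x : N.AreaState i × N.AreaAction i) =>
      D.Q i q₀ t ω x.1 x.2 - (N.areaMDP i).optQ x.1 x.2)
    (g := fun t x => N.γ * ∑ z, N.transProb i x.1 x.2 z * (D.tableValue i q₀ t ω z - V z))
    (w := fun t _ => -D.failNoise i t ω +
      N.γ * ∑ z, D.tableValue i q₀ t ω z * D.visitNoise i z t ω)
    (α := fun x t => D.stepSize i x t ω)
    (fun x t => D.stepSize_nonneg i x t ω)
    (fun x t => (D.stepSize_le_rate i x t ω).trans (D.rate_le_one i t ω))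
    (fun x => hω.2 x.1 x.2) (fun t x => ?_) (fun x => ?_) N.γ_lt_one (fun t b hb x => ?_)
    ⟨B + B', fun t x => (abs_sub _ _).trans (add_le_add (hB t x) (hB' x))⟩ (s, a)
  · simpa using key.add_const ((N.areaMDP i).optQ s a)
  · have h1 := D.stepSize_mul_reward i x t ω
    have h2 := D.stepSize_mul_tableValue i q₀ x t ω
    have h3 := N.areaMDP_optQ i x.1 x.2
    simp only [mul_sub, Finset.sum_sub_distrib]
    rw [D.Q_succ i q₀ t ω x, mul_add, h1, mul_left_comm, h2]
    linear_combination (-D.stepSize i x t ω) * h3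
  · obtain ⟨L, hL⟩ := hf x
    choose l hl using hv x
    refine ⟨-L + N.γ * ∑ z, l z, (hL.neg.add
      ((tendsto_finsetSum Finset.univ fun z _ => hl z).const_mul N.γ)).congr fun T => ?_⟩
    rw [Finset.sum_comm, Finset.mul_sum, ← Finset.sum_neg_distrib, ← Finset.sum_add_distrib]
    refine Finset.sum_congr rfl fun t _ => ?_
    simp only [mul_assoc, ← Finset.mul_sum]
    ring
  · rw [abs_mul, abs_of_nonneg N.γ_nonneg]
    refine mul_le_mul_of_nonneg_left ?_ N.γ_nonneg
    -- Averaging with transition probabilities and taking maxima over actions do not increase the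
    -- sup norm, so `γ` is the contraction factor.
    calc |∑ z, N.transProb i x.1 x.2 z * (D.tableValue i q₀ t ω z - V z)|
        ≤ ∑ z, |N.transProb i x.1 x.2 z * (D.tableValue i q₀ t ω z - V z)| :=
          Finset.abs_sum_le_sum_abs _ _
      _ ≤ ∑ z, N.transProb i x.1 x.2 z * b := Finset.sum_le_sum fun z _ => by
          rw [abs_mul, abs_of_nonneg (N.transProb_nonneg i _ _ z)]
          exact mul_le_mul_of_nonneg_left (abs_ciSup_sub_ciSup_le fun c => hb (z, c))
            (N.transProb_nonneg i _ _ z)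
      _ = b := by rw [← Finset.sum_mul, sum_transProb, one_mul]

end Run

end SharingSystem

end

theorem proposition1 {ι : Type*} [Fintype ι] [DecidableEq ι] (N : SharingSystem ι) :
    -- every single-area problem and the multi-agent problem have solutions
    (∃ d : ∀ i, N.AreaState i → N.AreaAction i, ∀ i, (N.areaMDP i).Solves (d i)) ∧
    -- a combination of single-area policies solves the multi-agent problem
    -- exactly if each of them solves its single-area problem
    (∀ d : ∀ i, N.AreaState i → N.AreaAction i,
      (∀ i, (N.areaMDP i).Solves (d i)) ↔ N.jointMDP.Solves (N.combine d)) ∧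
    -- every solution of the multi-agent problem is, at each state, such a combination
    (∀ D : N.State → N.Action, N.jointMDP.Solves D ↔
      ∀ s, ∃ d : ∀ i, N.AreaState i → N.AreaAction i,
        (∀ i, (N.areaMDP i).Solves (d i)) ∧ D s = N.combine d s) ∧
    -- solutions are optimal among the randomised policies as well
    (∀ D : N.State → N.Action, N.jointMDP.Solves D → N.jointMDP.IsOptimal (MDP.pure D)) ∧
    -- the same for randomised policies
    (∀ π : ∀ i, MDP.Policy (N.AreaState i) (N.AreaAction i),
      (∀ i, (N.areaMDP i).IsOptimal (π i)) ↔ N.jointMDP.IsOptimal (N.combinePolicy π)) ∧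
    -- optimal values are sums of the single-area optimal values
    (∀ s, N.jointMDP.optValue s = ∑ i, (N.areaMDP i).optValue (N.proj s i)) ∧
    (∀ s a, N.jointMDP.optQ s a = ∑ i, (N.areaMDP i).optQ (N.proj s i) (a i)) ∧
    -- distributed Q-learning converges almost surely to the optimal solution
    (∀ {Ω : Type*} [MeasurableSpace Ω] (P : Measure Ω) [IsProbabilityMeasure P] (D : N.Run P)
      (q₀ : ∀ i, N.AreaState i → N.AreaAction i → ℝ), D.RobbinsMonro →
      ∀ᵐ ω ∂P,
        (∀ i s a, Tendsto (fun t => D.Q i (q₀ i) t ω s a) atTop (𝓝 ((N.areaMDP i).optQ s a))) ∧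
        (∀ s a, Tendsto (fun t => ∑ i, D.Q i (q₀ i) t ω (N.proj s i) (a i)) atTop
          (𝓝 (N.jointMDP.optQ s a))) ∧
        ∀ᶠ t in atTop, ∀ d : ∀ i, N.AreaState i → N.AreaAction i,
          (∀ i, IsGreedy (D.Q i (q₀ i) t ω) (d i)) → N.jointMDP.Solves (N.combine d)) := by
  refine ⟨?_, N.solves_combine_iff, N.solves_iff_exists_combine,
    fun D => (N.jointMDP_integrableReward.solves_iff_isOptimal D).1,
    N.isOptimal_combinePolicy_iff, N.jointMDP_optValue, N.jointMDP_optQ, ?_⟩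
  · choose d hd using fun i => (N.areaMDP_integrableReward i).exists_optQ_eq
    exact ⟨d, fun i => ((N.areaMDP_integrableReward i).solves_iff (d i)).2 (hd i)⟩
  · intro Ω _ P _ D q₀ hD
    filter_upwards [ae_all_iff.2 fun i => D.ae_tendsto_Q i (q₀ i) hD] with ω hω
    refine ⟨hω, fun s a => ?_, ?_⟩
    · rw [N.jointMDP_optQ]
      exact tendsto_finsetSum _ fun i _ => hω i _ _
    · filter_upwards [eventually_all.2 fun i => eventually_forall_isGreedy_eq (hω i)]
        with t ht d hd
      exact (N.solves_combine_iff d).1 fun i =>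
        ((N.areaMDP_integrableReward i).isGreedy_optQ_iff (d i)).1 (ht i (d i) (hd i))
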